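/- Let $\mathfrak P=\mathbb P(V)$ be the projective space of a finite-dimensional vector space $V$ over a field of characteristic $\neq 2$. Let $T,B$ be disjoint projective subspaces of $\mathfrak P$ ($T=\emptyset$ is allowed), let $Q$ be a nondegenerate quadric on $B$ which is ruled (contains a line), let $S_0=\bigcup_{x\in Q}\langle T,x\rangle$ be the projective cone with vertex $T$ over $Q$, and let $S=S_0\setminus T$. Dimensions are projective, with $\dim\emptyset=-1$. The generalized Laguerre space $\mathfrak L$ has point set $S$. Its lines are the nonempty sections with $S$ of the projective lines contained in $S_0$; a line is affine if the projective line meets $T$, and two affine lines are parallel if their projective lines meet $T$ in the same point. Its cycles are the sections of $S$ by planes that have at least three points and contain no line of $\mathfrak L$. Two cycles are tangent if they have a common point and a common tangent line there. A subspace of $\mathfrak L$ is a set $X\subset S$ such that for all lines $K,M$, all cycles $A,C$ and all points $a$: if $|K\cap X|\ge 2$ then $K\subset X$; if $a\in X\cap K$ and $K\parallel M\subset X$ then $K\subset X$; if $|A\cap X|\ge 3$ then $A\subset X$; if $|A\cap X|\ge 2$ and $A$ is tangent to some $C\subset X$ then $A\subset X$. A maximal proper subspace is a maximal element, under inclusion,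 of the set of subspaces $X\neq S$. The index of a quadric is the greatest dimension of a projective subspace contained in it. A $d$-dimensional quadric contained in $\mathfrak L$ is a nonempty section $S\cap U$, with $U$ a projective subspace of dimension $d+1$, that is a nondegenerate quadric of $U$. For $D\subset S$, the affine cone over $D$ with $m$-dimensional affine generator and vertex $T'$, where $T'\subset T$ and $\dim T'=m-1$, is $\bigcup_{x\in D}\langle T',x\rangle\setminus T'$. Let $\mathfrak l^m_{d,w}$ be the set of affine cones with $m$-dimensional affine generator over a $d$-dimensional quadric of index $w$ contained in $\mathfrak L$. Let $\mathfrak s^{m,m'}_{d,w}$ be the set of affine cones with $m$-dimensional affine generator over a projective cone $\bigcup_{x\in D}\langle W,x\rangle\subset S$, where $D=S\cap U$ is a $d$-dimensional quadric of index $w$ contained in $\mathfrak L$ and the vertex $W$ is disjoint from $U$ with $\dim W=m'-w-1$ (so that the projective cone has $m'$-dimensional generators). Put $\nu=\dim Q=\dim B-1$, let $t$ be the index of $Q$, and put $a=\dim T+1$. Then every maximal proper subspace of $\mathfrak L$ belongs to one of the four classes $$\mathfrak l^{a}_{\nu-1,t-1},\qquad \mathfrak l^{a}_{\nu-1,t},\qquad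 \mathfrak l^{a-1}_{\nu,t},\qquad \mathfrak s^{a,t}_{\nu-2,t-1}$$ (a class with a parameter for which no such object exists is empty). -/

import Mathlib

open scoped LinearAlgebra.Projectivization

namespace Laguerre

variable {K V : Type*} [Field K] [AddCommGroup V] [Module K V]

/-- The set of points of the projective subspace of `ℙ K V` given by the linear subspace `U`. -/
def points (U : Submodule K V) : Set (ℙ K V) := {p | p.submodule ≤ U}

/-- The projective dimension of a subspace; the empty subspace `⊥` has dimension `-1`. -/
noncomputable def projDim (U : Submodule K V) : ℤ := (Module.finrank K U : ℤ) - 1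

/-- The projective quadric with equation `q = 0` on the projective subspace given by `B`. -/
def quadricPoints (B : Submodule K V) (q : QuadraticForm K B) : Set (ℙ K V) :=
  {p | ∃ b : B, b ≠ 0 ∧ (b : V) ∈ p.submodule ∧ q b = 0}

/-- The projective cone with vertex `U` over the set of points `D`: the union of all joins
`U + x` with `x ∈ D`. It contains the points of `U` as soon as `D` is nonempty. -/
def cone (U : Submodule K V) (D : Set (ℙ K V)) : Set (ℙ K V) :=
  {p | ∃ x ∈ D, p.submodule ≤ U ⊔ x.submodule}

/-- `w` is the index of the set of points `Y`, i.e. the greatest projective dimension of a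
projective subspace contained in `Y`. -/
def HasIndex (Y : Set (ℙ K V)) (w : ℤ) : Prop :=
  IsGreatest {k : ℤ | ∃ M : Submodule K V, points M ⊆ Y ∧ projDim M = k} w

end Laguerre

/-- The data defining a generalized Laguerre space inside the projective space `ℙ K V`:
disjoint projective subspaces `T`, `B` and a nondegenerate ruled quadric `form = 0` on `B`.
Ruled means that the quadric contains a line. -/
structure LaguerreSpace (K V : Type*) [Field K] [AddCommGroup V] [Module K V] where
  T : Submodule K V
  B : Submodule K V
  disjoint : Disjoint T B
  form : QuadraticForm K B
  nondegenerate : form.Nondegenerate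
  ruled : ∃ M : Submodule K V, Laguerre.projDim M = 1 ∧
    Laguerre.points M ⊆ Laguerre.quadricPoints B form

namespace LaguerreSpace

open Laguerre

variable {K V : Type*} [Field K] [AddCommGroup V] [Module K V] (L : LaguerreSpace K V)

/-- The basic quadric. -/
def quadric : Set (ℙ K V) := quadricPoints L.B L.form

/-- The cone with vertex `T` over the basic quadric. -/
def S₀ : Set (ℙ K V) := cone L.T L.quadric

/-- The set of points of the Laguerre space: the cone with its vertex deleted. -/
def S : Set (ℙ K V) := L.S₀ \ points L.T

/-- All lines: nonempty sections with `S` of the projective lines lying on the cone. -/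
def lines : Set (Set (ℙ K V)) :=
  {k | ∃ ℓ : Submodule K V, projDim ℓ = 1 ∧ points ℓ ⊆ L.S₀ ∧
    k = L.S ∩ points ℓ ∧ k.Nonempty}

/-- The natural parallelism of affine lines: `k` and `m` are sections of projective lines lying
on the cone that meet `T` in the same point `e`. -/
def Parallel (k m : Set (ℙ K V)) : Prop :=
  ∃ ℓ ℓ' : Submodule K V, ∃ e ∈ points L.T,
    (projDim ℓ = 1 ∧ points ℓ ⊆ L.S₀ ∧ k = L.S ∩ points ℓ ∧ k.Nonempty ∧ e ∈ points ℓ) ∧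
    (projDim ℓ' = 1 ∧ points ℓ' ⊆ L.S₀ ∧ m = L.S ∩ points ℓ' ∧ m.Nonempty ∧ e ∈ points ℓ')

/-- `A` is the cycle cut out of `S` by the projective plane `α`: a section containing no line,
and nontrivial, that is, having at least three points. -/
def IsCycleOn (A : Set (ℙ K V)) (α : Submodule K V) : Prop :=
  projDim α = 2 ∧ A = L.S ∩ points α ∧ 3 ≤ A.encard ∧ ∀ k ∈ L.lines, ¬ k ⊆ A

/-- The cycles (conics) of the Laguerre space. -/
def cycles : Set (Set (ℙ K V)) := {A | ∃ α : Submodule K V, L.IsCycleOn A α}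

/-- Tangency of cycles: they have a common point `p` and a common tangent line `ℓ` at `p`.
A line in the plane of a cycle is tangent to it if it meets it in exactly one point. -/
def Tangent (A C : Set (ℙ K V)) : Prop :=
  ∃ α β ℓ : Submodule K V, ∃ p : ℙ K V, L.IsCycleOn A α ∧ L.IsCycleOn C β ∧
    projDim ℓ = 1 ∧ ℓ ≤ α ∧ ℓ ≤ β ∧ A ∩ points ℓ = {p} ∧ C ∩ points ℓ = {p}

/-- Subspaces of the Laguerre space. -/
structure IsSubspace (X : Set (ℙ K V)) : Prop where
  subset : X ⊆ L.S
  line_subset : ∀ k ∈ L.lines, 2 ≤ (k ∩ X).encard → k ⊆ X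
  parallel_subset : ∀ k m : Set (ℙ K V), L.Parallel k m → m ⊆ X → (X ∩ k).Nonempty → k ⊆ X
  cycle_subset : ∀ A ∈ L.cycles, 3 ≤ (A ∩ X).encard → A ⊆ X
  tangent_subset : ∀ A C : Set (ℙ K V), L.Tangent A C → C ⊆ X → 2 ≤ (X ∩ A).encard → A ⊆ X

/-- Maximal elements, with respect to inclusion, of the family of subspaces other than `S`. -/
def IsMaximalProperSubspace (X : Set (ℙ K V)) : Prop :=
  Maximal (fun Y => L.IsSubspace Y ∧ Y ≠ L.S) X

/-- `D` is a `d`-dimensional quadric of index `w` contained in the Laguerre space: a nonempty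
section of `S` with a projective `(d+1)`-space `U` which is a nondegenerate quadric of `U`. -/
def IsSubquadric (U : Submodule K V) (D : Set (ℙ K V)) (d w : ℤ) : Prop :=
  projDim U = d + 1 ∧ D = L.S ∩ points U ∧ D.Nonempty ∧
    (∃ q : QuadraticForm K U, q.Nondegenerate ∧ D = quadricPoints U q) ∧ HasIndex D w

/-- `X` is an affine cone over `D ⊆ S` with `m`-dimensional affine generators: the projective cone
over `D` with an `(m-1)`-dimensional vertex contained in `T`, the vertex deleted. -/
def IsAffineCone (X D : Set (ℙ K V)) (m : ℤ) : Prop :=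
  ∃ T' : Submodule K V, T' ≤ L.T ∧ projDim T' = m - 1 ∧ X = cone T' D \ points T'

/-- The class `𝔩^m_{d,w}`. -/
def classL (m d w : ℤ) : Set (Set (ℙ K V)) :=
  {X | ∃ (U : Submodule K V) (D : Set (ℙ K V)), L.IsSubquadric U D d w ∧ L.IsAffineCone X D m}

/-- The class `𝔰^{m,m'}_{d,w}`: affine cones with `m`-dimensional affine generators over a
projective cone contained in `S`, with `m'`-dimensional generators (that is, with a vertex `W` of
dimension `m' - w - 1`), over a `d`-dimensional quadric of index `w`. -/
def classS (m m' d w : ℤ) : Set (Set (ℙ K V)) :=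
  {X | ∃ (U W : Submodule K V) (D : Set (ℙ K V)), L.IsSubquadric U D d w ∧
    Disjoint W U ∧ projDim W = m' - w - 1 ∧ cone W D ⊆ L.S ∧ L.IsAffineCone X (cone W D) m}

/-- The dimension of the basic quadric. -/
noncomputable def ν : ℤ := projDim L.B - 1

/-- The dimension of a maximal affine generator. -/
noncomputable def a : ℤ := projDim L.T + 1

end LaguerreSpace

open Module

namespace Laguerre

variable {K V : Type*} [Field K] [AddCommGroup V] [Module K V]

/-! Extend the form of the quadric by zero along a projection onto B that kills T; call it `qf`,
with polar form `bil`. Points of the Laguerre space are then the vectors of T + B that are singular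
for `qf` and have nonzero projection, and two distinct points u, v are collinear exactly when `bil u
v = 0`.

The heart is that every subspace X is a section of S by a projective subspace
(`IsSubspace.exists_eq_inter_points`). Take M maximal among the spans of points all of whose points
lie in X, and let p be in X. Up to scaling, a point of M + p outside M is r = p + m with m in M. If
m lies in T, then r lies on the parallel through p to a line in X; if m is a point, r lies on the
line pm. Otherwise m is nonsingular and lies on a secant uv of M, and r lies in the plane of u, v,
p. This plane cuts out a cycle or degenerates; in the second case lines and parallels reach r.
Maximality then puts p in M.

Conversely all such sections are subspaces, and S spans T + B, so a maximal proper subspace is the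
section by a hyperplane f = 0. If f does not vanish on T, the hyperplane contains an isometric copy
of B and its intersection with T drops by one dimension. If f vanishes on T, then f = `bil x` on T +
B for some x in B. For nonsingular x the orthogonal of x in B is nondegenerate, and the index t
drops by at most one. For singular x the section of the quadric is a cone with vertex x over a
nondegenerate quadric of index t - 1. -/

theorem mk_mem_points {U : Submodule K V} {v : V} (hv : v ≠ 0) :
    Projectivization.mk K v hv ∈ points U ↔ v ∈ U := by
  simp [points, Projectivization.submodule_mk, Submodule.span_singleton_le_iff_mem]

theorem mem_points_iff {U : Submodule K V} {p : ℙ K V} : p ∈ points U ↔ p.rep ∈ U := by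
  conv_lhs => rw [← p.mk_rep]
  exact mk_mem_points _

theorem points_mono {U W : Submodule K V} (h : U ≤ W) : points U ⊆ points W :=
  fun _ hp => le_trans hp h

theorem points_subset_points {U W : Submodule K V} : points U ⊆ points W ↔ U ≤ W := by
  refine ⟨fun h v hv => ?_, points_mono⟩
  by_cases h0 : v = 0
  · simp [h0]
  · exact (mk_mem_points h0).1 (h ((mk_mem_points h0).2 hv))

theorem mk_mem_quadricPoints {U : Submodule K V} {q : QuadraticForm K U} {v : V} (hv : v ≠ 0) :
    Projectivization.mk K v hv ∈ quadricPoints U q ↔ ∃ h : v ∈ U, q ⟨v, h⟩ = 0 := by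
  simp only [quadricPoints, Set.mem_ofPred_eq, Projectivization.submodule_mk,
    Submodule.mem_span_singleton]
  constructor
  · rintro ⟨b, hb, ⟨c, hc⟩, hq⟩
    have hc0 : c ≠ 0 := by
      rintro rfl
      exact hb (Subtype.ext (by simpa using hc.symm))
    have hv' : v = c⁻¹ • (b : V) := by rw [← hc, smul_smul, inv_mul_cancel₀ hc0, one_smul]
    refine ⟨hv' ▸ U.smul_mem _ b.2, ?_⟩
    have : (⟨v, hv' ▸ U.smul_mem _ b.2⟩ : U) = c⁻¹ • b := Subtype.ext hv'
    rw [this, QuadraticMap.map_smul, hq, smul_zero]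
  · rintro ⟨h, hq⟩
    exact ⟨⟨v, h⟩, fun h' => hv (congrArg Subtype.val h'), ⟨1, one_smul _ _⟩, hq⟩

theorem mk_mem_cone {U : Submodule K V} {D : Set (ℙ K V)} {v : V} (hv : v ≠ 0) :
    Projectivization.mk K v hv ∈ cone U D ↔
      ∃ (x : V) (hx : x ≠ 0), Projectivization.mk K x hx ∈ D ∧ ∃ (w : V) (c : K),
        w ∈ U ∧ v = w + c • x := by
  simp only [cone, Set.mem_ofPred_eq, Projectivization.submodule_mk,
    Submodule.span_singleton_le_iff_mem]
  constructor
  · rintro ⟨x, hx, h⟩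
    rw [x.submodule_eq] at h
    obtain ⟨w, hw, y, hy, rfl⟩ := Submodule.mem_sup.1 h
    obtain ⟨c, rfl⟩ := Submodule.mem_span_singleton.1 hy
    exact ⟨x.rep, x.rep_nonzero, by rwa [x.mk_rep], w, c, hw, rfl⟩
  · rintro ⟨x, hx, hD, w, c, hw, rfl⟩
    refine ⟨_, hD, ?_⟩
    rw [Projectivization.submodule_mk]
    exact Submodule.add_mem_sup hw (Submodule.smul_mem _ _ (Submodule.mem_span_singleton_self x))

/-! ### Spans and dimension counts. -/

theorem projDim_eq_iff {U : Submodule K V} {n : ℕ} {d : ℤ} (hd : d = (n : ℤ) - 1) :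
    projDim U = d ↔ finrank K U = n := by
  unfold projDim
  omega

theorem finrank_span_pair_of_linearIndependent {u w : V} (h : LinearIndependent K ![u, w]) :
    finrank K (Submodule.span K {u, w}) = 2 := by
  have := finrank_span_eq_card h
  rwa [Matrix.range_cons_cons_empty, Fintype.card_fin] at this

theorem finrank_span_triple_of_linearIndependent {u v w : V}
    (h : LinearIndependent K ![u, v, w]) :
    finrank K (Submodule.span K {u, v, w}) = 3 := by
  have := finrank_span_eq_card h
  rwa [Matrix.range_cons, Matrix.range_cons_cons_empty, Fintype.card_fin] at this

theorem linearIndependent_triple_of_notMem_span {u v w : V} (h : LinearIndependent K ![u, v])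
    (hw : w ∉ Submodule.span K {u, v}) : LinearIndependent K ![u, v, w] := by
  have hi : Fin.init ![u, v, w] = ![u, v] := by
    ext i; fin_cases i <;> rfl
  rw [linearIndependent_finSucc', hi, Matrix.range_cons_cons_empty]
  exact ⟨h, hw⟩

theorem linearIndependent_pair_of_mk_ne {u w : V} {hu : u ≠ 0} {hw : w ≠ 0}
    (h : Projectivization.mk K u hu ≠ Projectivization.mk K w hw) :
    LinearIndependent K ![u, w] := by
  rw [LinearIndependent.pair_iff' hu]
  intro a ha
  exact h ((Projectivization.mk_eq_mk_iff' K u w hu hw).2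
    ⟨a⁻¹, by
      have : a ≠ 0 := by rintro rfl; exact hw (by simpa using ha.symm)
      rw [← ha, smul_smul, inv_mul_cancel₀ this, one_smul]⟩)

theorem mk_ne_of_linearIndependent_pair {u w : V} (hu : u ≠ 0) (hw : w ≠ 0)
    (h : LinearIndependent K ![u, w]) :
    Projectivization.mk K u hu ≠ Projectivization.mk K w hw := by
  intro h'
  obtain ⟨a, ha⟩ := (Projectivization.mk_eq_mk_iff' K u w hu hw).1 h'
  have := (LinearIndependent.pair_iff.1 h) 1 (-a) (by rw [ha.symm]; simp)
  simp at this

theorem finrank_map_of_injOn {M : Submodule K V} {g : V →ₗ[K] V} (h : ∀ v ∈ M, g v = 0 → v = 0) :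
    finrank K (M.map g) = finrank K M := by
  rw [← LinearMap.range_domRestrict]
  refine LinearMap.finrank_range_of_inj ((injective_iff_map_eq_zero _).2 fun v hv => ?_)
  exact Subtype.ext (h v v.2 hv)

variable [FiniteDimensional K V]

theorem eq_span_pair {ℓ : Submodule K V} (hℓ : projDim ℓ = 1) {u w : V} (hu : u ∈ ℓ) (hw : w ∈ ℓ)
    (h : LinearIndependent K ![u, w]) : Submodule.span K {u, w} = ℓ := by
  refine Submodule.eq_of_le_of_finrank_eq (Submodule.span_le.2 ?_) ?_
  · rintro x (rfl | rfl) <;> assumption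
  · rw [finrank_span_pair_of_linearIndependent h, (projDim_eq_iff (n := 2) (by norm_num)).1 hℓ]

theorem eq_span_triple {α : Submodule K V} (hα : projDim α = 2) {u v w : V} (hu : u ∈ α)
    (hv : v ∈ α) (hw : w ∈ α) (h : LinearIndependent K ![u, v, w]) :
    Submodule.span K {u, v, w} = α := by
  refine Submodule.eq_of_le_of_finrank_eq (Submodule.span_le.2 ?_) ?_
  · rintro x (rfl | rfl | rfl) <;> assumption
  · rw [finrank_span_triple_of_linearIndependent h, (projDim_eq_iff (n := 3) (by norm_num)).1 hα]

theorem exists_ne_zero_mem_inf {N P A : Submodule K V} (hN : N ≤ A) (hP : P ≤ A)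
    (h : finrank K A < finrank K N + finrank K P) : ∃ w ∈ N, w ∈ P ∧ w ≠ 0 := by
  have h1 := Submodule.finrank_sup_add_finrank_inf_eq N P
  have h2 := Submodule.finrank_mono (sup_le hN hP)
  have h3 : N ⊓ P ≠ ⊥ := by
    intro h0
    rw [h0, finrank_bot] at h1
    omega
  obtain ⟨w, hw, h0⟩ := Submodule.exists_mem_ne_zero_of_ne_bot h3
  exact ⟨w, hw.1, hw.2, h0⟩

/-- A hyperplane meets a subspace in a subspace of codimension at most one. -/
theorem finrank_le_finrank_inf_ker_add_one (N : Submodule K V) (f : V →ₗ[K] K) :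
    finrank K N ≤ finrank K (N ⊓ LinearMap.ker f : Submodule K V) + 1 := by
  have h1 := LinearMap.finrank_range_add_finrank_ker (f.domRestrict N)
  have h2 : finrank K (LinearMap.range (f.domRestrict N)) ≤ 1 := by
    simpa using Submodule.finrank_le (LinearMap.range (f.domRestrict N))
  have h3 : (LinearMap.ker (f.domRestrict N)).map N.subtype = N ⊓ LinearMap.ker f := by
    ext x
    simp only [Submodule.mem_map, LinearMap.mem_ker, Submodule.mem_inf]
    constructor
    · rintro ⟨y, hy, rfl⟩
      exact ⟨y.2, hy⟩
    · rintro ⟨hx, hf⟩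
      exact ⟨⟨x, hx⟩, hf, rfl⟩
  rw [← h3, Submodule.finrank_map_subtype_eq]
  omega

theorem finrank_inf_ker_add_one {N : Submodule K V} {f : V →ₗ[K] K} {x : V} (hx : x ∈ N)
    (hf : f x ≠ 0) : finrank K (N ⊓ LinearMap.ker f : Submodule K V) + 1 = finrank K N := by
  refine le_antisymm (Submodule.finrank_lt_finrank_of_lt ?_) (finrank_le_finrank_inf_ker_add_one N f)
  exact lt_of_le_of_ne inf_le_left fun h => hf (h.ge hx).2

theorem finrank_sup_span_singleton_of_notMem {N : Submodule K V} {x : V} (hx : x ∉ N) :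
    finrank K (N ⊔ Submodule.span K {x} : Submodule K V) = finrank K N + 1 := by
  have hx0 : x ≠ 0 := by rintro rfl; exact hx N.zero_mem
  have h1 := Submodule.finrank_sup_add_finrank_inf_eq N (Submodule.span K {x})
  rw [(Submodule.disjoint_span_singleton' hx0).2 hx |>.eq_bot, finrank_bot,
    finrank_span_singleton hx0] at h1
  simpa using h1

end Laguerre

/-! ### The quadratic form on the ambient space. -/

namespace LaguerreSpace

open Laguerre

variable {K V : Type*} [Field K] [AddCommGroup V] [Module K V] (L : LaguerreSpace K V)

/-- The span of the cone `S₀`. -/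
def ambient : Submodule K V := L.T ⊔ L.B

theorem T_le_ambient : L.T ≤ L.ambient := le_sup_left

theorem B_le_ambient : L.B ≤ L.ambient := le_sup_right

/-- A complement of `B` containing `T`. -/
noncomputable def compl : Submodule K V := L.disjoint.exists_isCompl.choose

theorem T_le_compl : L.T ≤ L.compl := L.disjoint.exists_isCompl.choose_spec.1

theorem isCompl_compl : IsCompl L.B L.compl := L.disjoint.exists_isCompl.choose_spec.2.symm

/-- A projection onto `B` vanishing on `T`. -/
noncomputable def proj : V →ₗ[K] L.B := Submodule.projectionOnto L.B L.compl L.isCompl_compl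

theorem proj_of_mem_B {v : V} (hv : v ∈ L.B) : L.proj v = ⟨v, hv⟩ :=
  Submodule.projectionOnto_apply_of_mem_left _ hv

theorem proj_of_mem_T {v : V} (hv : v ∈ L.T) : L.proj v = 0 :=
  (Submodule.projectionOnto_apply_eq_zero_iff _).2 (L.T_le_compl hv)

theorem proj_proj (v : V) : L.proj (L.proj v : V) = L.proj v := L.proj_of_mem_B (L.proj v).2

theorem sub_proj_mem_T {v : V} (hv : v ∈ L.ambient) : v - L.proj v ∈ L.T := by
  obtain ⟨x, hx, b, hb, rfl⟩ := Submodule.mem_sup.1 hv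
  rw [map_add, L.proj_of_mem_T hx, L.proj_of_mem_B hb]
  simpa using hx

theorem proj_eq_zero_iff {v : V} (hv : v ∈ L.ambient) : L.proj v = 0 ↔ v ∈ L.T := by
  refine ⟨fun h => ?_, L.proj_of_mem_T⟩
  simpa [h] using L.sub_proj_mem_T hv

/-- The extension of the form of the basic quadric by zero along `proj`. -/
noncomputable def qf : QuadraticForm K V := L.form.comp L.proj

/-- The polar form of `qf`. -/
noncomputable def bil : LinearMap.BilinForm K V := QuadraticMap.polarBilin L.qf

theorem qf_apply (v : V) : L.qf v = L.form (L.proj v) := rfl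

theorem qf_add (v w : V) : L.qf (v + w) = L.qf v + L.qf w + L.bil v w := by
  simp [bil, QuadraticMap.polar]

theorem qf_smul (c : K) (v : V) : L.qf (c • v) = c * c * L.qf v := by
  simp [QuadraticMap.map_smul]

theorem bil_comm (v w : V) : L.bil v w = L.bil w v := by
  simp [bil, QuadraticMap.polar_comm]

theorem bil_self (v : V) : L.bil v v = 2 * L.qf v := by
  simp [bil, QuadraticMap.polar_self]

theorem bil_apply (v w : V) :
    L.bil v w = QuadraticMap.polarBilin L.form (L.proj v) (L.proj w) := by
  simp [bil, QuadraticMap.polar, qf_apply]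

theorem bil_eq_zero_of_proj_eq_zero {v : V} (h : L.proj v = 0) (w : V) : L.bil v w = 0 := by
  rw [bil_apply, h]; simp

theorem qf_proj (v : V) : L.qf (L.proj v : V) = L.qf v := by
  rw [qf_apply, qf_apply, proj_proj]

theorem qf_add_smul (p m : V) (c : K) : L.qf (p + c • m) =
    L.qf p + c * c * L.qf m + c * L.bil p m := by
  simp [qf_add, qf_smul]

/-- The form is nondegenerate on `B`. -/
theorem eq_zero_of_bil_eq_zero (h2 : (2 : K) ≠ 0) {v : V} (hv : v ∈ L.B)
    (h : ∀ b ∈ L.B, L.bil v b = 0) : v = 0 := by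
  have h0 : (⟨v, hv⟩ : L.B) ∈ L.form.radical := by
    have hb : QuadraticMap.polarBilin L.form ⟨v, hv⟩ = 0 := by
      ext b
      have := h b b.2
      rw [bil_apply, L.proj_of_mem_B hv, L.proj_of_mem_B b.2] at this
      exact this
    -- The radical also requires the form to vanish at v, which follows from `bil v v = 2 * qf v`
    -- and 2 ≠ 0.
    refine ⟨?_, hb⟩
    have h3 := L.bil_self v
    rw [h v hv, L.qf_apply, L.proj_of_mem_B hv] at h3
    exact (mul_eq_zero.1 h3.symm).resolve_left h2
  rw [L.nondegenerate.radical_eq_bot, Submodule.mem_bot] at h0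
  exact congrArg Subtype.val h0

theorem mk_mem_quadric {v : V} (hv : v ≠ 0) :
    Projectivization.mk K v hv ∈ L.quadric ↔ v ∈ L.B ∧ L.qf v = 0 := by
  rw [quadric, mk_mem_quadricPoints]
  constructor
  · rintro ⟨h, hq⟩
    exact ⟨h, by rw [qf_apply, L.proj_of_mem_B h, hq]⟩
  · rintro ⟨h, hq⟩
    exact ⟨h, by rwa [qf_apply, L.proj_of_mem_B h] at hq⟩

/-- The quadric contains a point. -/
theorem exists_singular : ∃ v ∈ L.B, v ≠ 0 ∧ L.qf v = 0 := by
  obtain ⟨M, hM, hQ⟩ := L.ruled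
  have hM0 : M ≠ ⊥ := by
    rintro rfl
    simp [projDim] at hM
  obtain ⟨v, hv, h0⟩ := Submodule.exists_mem_ne_zero_of_ne_bot hM0
  obtain ⟨h1, h3⟩ := (L.mk_mem_quadric h0).1 (hQ ((mk_mem_points h0).2 hv))
  exact ⟨v, h1, h0, h3⟩

theorem mk_mem_S₀ {v : V} (hv : v ≠ 0) :
    Projectivization.mk K v hv ∈ L.S₀ ↔ v ∈ L.ambient ∧ L.qf v = 0 := by
  rw [S₀, mk_mem_cone]
  constructor
  · rintro ⟨x, hx, hD, w, c, hw, rfl⟩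
    obtain ⟨hxB, hq⟩ := (L.mk_mem_quadric hx).1 hD
    refine ⟨L.ambient.add_mem (L.T_le_ambient hw) (L.ambient.smul_mem _ (L.B_le_ambient hxB)), ?_⟩
    rw [qf_add_smul, hq, bil_eq_zero_of_proj_eq_zero _ (L.proj_of_mem_T hw), qf_apply,
      L.proj_of_mem_T hw]
    simp
  · rintro ⟨hE, hq⟩
    have hT := L.sub_proj_mem_T hE
    -- A vector of T needs some base point, taken with coefficient zero; any point of the quadric
    -- will do.
    by_cases h0 : (L.proj v : V) = 0
    · obtain ⟨x, hxB, hx0, hxq⟩ := L.exists_singular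
      refine ⟨x, hx0, (L.mk_mem_quadric hx0).2 ⟨hxB, hxq⟩, v, 0, by simpa [h0] using hT, by simp⟩
    · exact ⟨L.proj v, h0, (L.mk_mem_quadric h0).2 ⟨(L.proj v).2, by rw [qf_proj, hq]⟩,
        v - L.proj v, 1, hT, by simp⟩

/-! ### Points and point sets through representing vectors. -/

/-- `v` represents a point of the Laguerre space. -/
structure IsPt (v : V) : Prop where
  mem : v ∈ L.ambient
  ne : L.proj v ≠ 0
  qf_eq : L.qf v = 0

variable {L} in
theorem IsPt.ne_zero {v : V} (h : L.IsPt v) : v ≠ 0 := by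
  rintro rfl
  exact h.ne (map_zero _)

theorem mk_mem_S {v : V} (hv : v ≠ 0) : Projectivization.mk K v hv ∈ L.S ↔ L.IsPt v := by
  rw [S, Set.mem_sdiff, mk_mem_S₀, mk_mem_points]
  constructor
  · rintro ⟨⟨h1, h2⟩, h3⟩
    exact ⟨h1, fun h => h3 ((L.proj_eq_zero_iff h1).1 h), h2⟩
  · rintro ⟨h1, h3, h2⟩
    exact ⟨⟨h1, h2⟩, fun h => h3 (L.proj_of_mem_T h)⟩

/-- Vectors of zero projection are orthogonal to everything, so a single nonzero value of the polar
form keeps v out of T. -/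
theorem IsPt.of_bil {v w : V} (hv : v ∈ L.ambient) (hq : L.qf v = 0) (h : L.bil v w ≠ 0) :
    L.IsPt v :=
  ⟨hv, fun h0 => h (L.bil_eq_zero_of_proj_eq_zero h0 w), hq⟩

theorem qf_eq_zero_of_points_subset {M : Submodule K V} (h : points M ⊆ L.S₀) {v : V}
    (hv : v ∈ M) : v ∈ L.ambient ∧ L.qf v = 0 := by
  by_cases h0 : v = 0
  · subst h0; simp
  · exact (L.mk_mem_S₀ h0).1 (h ((mk_mem_points h0).2 hv))

theorem bil_eq_zero_of_points_subset {M : Submodule K V} (h : points M ⊆ L.S₀) {v w : V}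
    (hv : v ∈ M) (hw : w ∈ M) : L.bil v w = 0 := by
  have := L.qf_add v w
  rw [(L.qf_eq_zero_of_points_subset h hv).2, (L.qf_eq_zero_of_points_subset h hw).2,
    (L.qf_eq_zero_of_points_subset h (M.add_mem hv hw)).2] at this
  simpa using this.symm

theorem points_subset_S₀ {M : Submodule K V} (h : ∀ v ∈ M, v ∈ L.ambient ∧ L.qf v = 0) :
    points M ⊆ L.S₀ := by
  intro p hp
  rw [← p.mk_rep] at hp ⊢
  exact (L.mk_mem_S₀ _).2 (h _ ((mk_mem_points _).1 hp))

theorem points_span_pair_subset_S₀ {u w : V} (hu : u ∈ L.ambient) (hw : w ∈ L.ambient)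
    (hqu : L.qf u = 0) (hqw : L.qf w = 0) (hb : L.bil u w = 0) :
    points (Submodule.span K {u, w}) ⊆ L.S₀ := by
  refine L.points_subset_S₀ fun v hv => ?_
  obtain ⟨a, b, rfl⟩ := Submodule.mem_span_pair.1 hv
  exact ⟨L.ambient.add_mem (L.ambient.smul_mem _ hu) (L.ambient.smul_mem _ hw), by
    simp [qf_add_smul, qf_smul, hqu, hqw, hb]⟩

/-- The nonzero vector `v` represents a point of `X`. -/
def Has (X : Set (ℙ K V)) (v : V) : Prop := ∃ h : v ≠ 0, Projectivization.mk K v h ∈ X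

theorem Has.smul {X : Set (ℙ K V)} {v : V} (h : Has X v) {c : K} (hc : c ≠ 0) :
    Has X (c • v) := by
  obtain ⟨h0, hX⟩ := h
  refine ⟨smul_ne_zero hc h0, ?_⟩
  rwa [(Projectivization.mk_eq_mk_iff' K _ _ _ h0).2 ⟨c, rfl⟩]

theorem has_rep {X : Set (ℙ K V)} {p : ℙ K V} : Has X p.rep ↔ p ∈ X := by
  simp [Has, p.rep_nonzero]

theorem has_S {v : V} : Has L.S v ↔ L.IsPt v :=
  ⟨fun ⟨h, hS⟩ => (L.mk_mem_S h).1 hS, fun h => ⟨h.ne_zero, (L.mk_mem_S h.ne_zero).2 h⟩⟩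

theorem subset_iff_has {X Y : Set (ℙ K V)} : X ⊆ Y ↔ ∀ v, Has X v → Has Y v :=
  ⟨fun h _ ⟨h0, hX⟩ => ⟨h0, h hX⟩, fun h _ hp => has_rep.1 (h _ (has_rep.2 hp))⟩

theorem has_inter_points {X : Set (ℙ K V)} {M : Submodule K V} {v : V} :
    Has (X ∩ points M) v ↔ Has X v ∧ v ∈ M :=
  ⟨fun ⟨h0, h⟩ => ⟨⟨h0, h.1⟩, (mk_mem_points h0).1 h.2⟩,
    fun ⟨⟨h0, h⟩, hM⟩ => ⟨h0, h, (mk_mem_points h0).2 hM⟩⟩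

theorem two_le_encard {X : Set (ℙ K V)} {u w : V} (hu : Has X u) (hw : Has X w)
    (h : LinearIndependent K ![u, w]) : 2 ≤ X.encard := by
  obtain ⟨hu0, hu⟩ := hu
  obtain ⟨hw0, hw⟩ := hw
  rw [← Set.encard_pair (mk_ne_of_linearIndependent_pair hu0 hw0 h)]
  exact Set.encard_le_encard (Set.insert_subset hu (Set.singleton_subset_iff.2 hw))

theorem three_le_encard {X : Set (ℙ K V)} {u v w : V} (hu : Has X u) (hv : Has X v) (hw : Has X w)
    (huv : LinearIndependent K ![u, v]) (huw : LinearIndependent K ![u, w])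
    (hvw : LinearIndependent K ![v, w]) : 3 ≤ X.encard := by
  obtain ⟨hu0, hu⟩ := hu
  obtain ⟨hv0, hv⟩ := hv
  obtain ⟨hw0, hw⟩ := hw
  rw [← Set.encard_eq_three.2 ⟨_, _, _, mk_ne_of_linearIndependent_pair hu0 hv0 huv,
    mk_ne_of_linearIndependent_pair hu0 hw0 huw, mk_ne_of_linearIndependent_pair hv0 hw0 hvw, rfl⟩]
  exact Set.encard_le_encard
    (Set.insert_subset hu (Set.insert_subset hv (Set.singleton_subset_iff.2 hw)))

theorem exists_pair_of_two_le_encard {X : Set (ℙ K V)} (h : 2 ≤ X.encard) :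
    ∃ u w, Has X u ∧ Has X w ∧ LinearIndependent K ![u, w] := by
  obtain ⟨p, r, hp, hr, hne⟩ := Set.one_lt_encard_iff.1 (lt_of_lt_of_le (by norm_num) h)
  refine ⟨p.rep, r.rep, has_rep.2 hp, has_rep.2 hr,
    linearIndependent_pair_of_mk_ne (hu := p.rep_nonzero) (hw := r.rep_nonzero) ?_⟩
  rwa [p.mk_rep, r.mk_rep]

theorem exists_triple_of_three_le_encard {X : Set (ℙ K V)} (h : 3 ≤ X.encard) :
    ∃ u v w, Has X u ∧ Has X v ∧ Has X w ∧ LinearIndependent K ![u, v] ∧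
      LinearIndependent K ![u, w] ∧ LinearIndependent K ![v, w] := by
  obtain ⟨Y, hYX, hY⟩ := Set.exists_subset_encard_eq h
  obtain ⟨p, r, s, h1, h2, h3, rfl⟩ := Set.encard_eq_three.1 hY
  refine ⟨p.rep, r.rep, s.rep, has_rep.2 (hYX (by simp)), has_rep.2 (hYX (by simp)),
    has_rep.2 (hYX (by simp)),
    linearIndependent_pair_of_mk_ne (hu := p.rep_nonzero) (hw := r.rep_nonzero) ?_,
    linearIndependent_pair_of_mk_ne (hu := p.rep_nonzero) (hw := s.rep_nonzero) ?_,
    linearIndependent_pair_of_mk_ne (hu := r.rep_nonzero) (hw := s.rep_nonzero) ?_⟩ <;>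
  simpa [Projectivization.mk_rep]

theorem linearIndependent_of_bil_ne_zero {u v : V} (hu : L.qf u = 0) (hv : L.qf v = 0)
    (h : L.bil u v ≠ 0) : LinearIndependent K ![u, v] := by
  rw [LinearIndependent.pair_iff]
  intro s t hst
  have h1 : L.bil u (s • u + t • v) = 0 := by rw [hst]; simp
  have h3 : L.bil v (s • u + t • v) = 0 := by rw [hst]; simp
  simp only [map_add, map_smul, bil_self, hu, hv, smul_eq_mul, mul_zero, zero_add, add_zero,
    L.bil_comm v u] at h1 h3
  exact ⟨(mul_eq_zero.1 h3).resolve_right h, (mul_eq_zero.1 h1).resolve_right h⟩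

theorem linearIndependent_pair_of_mem_T {v e : V} (hv : L.proj v ≠ 0) (he : e ∈ L.T)
    (he0 : e ≠ 0) : LinearIndependent K ![v, e] := by
  rw [LinearIndependent.pair_iff]
  intro s t hst
  have h1 : L.proj (s • v + t • e) = 0 := by rw [hst]; simp
  have hs : s = 0 := by
    simpa [L.proj_of_mem_T he, hv] using h1
  subst hs
  exact ⟨rfl, by simpa [he0] using hst⟩

theorem projDim_span_pair {u w : V} (h : LinearIndependent K ![u, w]) :
    projDim (Submodule.span K {u, w}) = 1 :=
  (projDim_eq_iff (n := 2) (by norm_num)).2 (finrank_span_pair_of_linearIndependent h)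

/-! ### Closure of subspaces under lines, parallels and plane sections. -/

variable {L} {X : Set (ℙ K V)}

theorem IsSubspace.isPt (hX : L.IsSubspace X) {v : V} (h : Has X v) : L.IsPt v :=
  L.has_S.1 (subset_iff_has.1 hX.subset v h)

/-- A subspace contains the line through two of its collinear points. -/
theorem IsSubspace.has_of_line (hX : L.IsSubspace X) {u w v : V} (hu : Has X u) (hw : Has X w)
    (hi : LinearIndependent K ![u, w]) (hb : L.bil u w = 0) (hv : v ∈ Submodule.span K {u, w})
    (hp : L.proj v ≠ 0) : Has X v := by
  have hu' := hX.isPt hu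
  have hw' := hX.isPt hw
  have hS := L.points_span_pair_subset_S₀ hu'.mem hw'.mem hu'.qf_eq hw'.qf_eq hb
  have hku : Has (L.S ∩ points (Submodule.span K {u, w})) u :=
    has_inter_points.2 ⟨L.has_S.2 hu', Submodule.subset_span (by simp)⟩
  have hkw : Has (L.S ∩ points (Submodule.span K {u, w})) w :=
    has_inter_points.2 ⟨L.has_S.2 hw', Submodule.subset_span (by simp)⟩
  refine subset_iff_has.1 (hX.line_subset (L.S ∩ points (Submodule.span K {u, w}))
    ⟨_, projDim_span_pair hi, hS, rfl, ⟨_, hku.2⟩⟩ ?_) v ?_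
  · exact two_le_encard (u := u) (w := w) ⟨hu.1, hku.2, hu.2⟩ ⟨hw.1, hkw.2, hw.2⟩ hi
  · obtain ⟨h1, h3⟩ := L.qf_eq_zero_of_points_subset hS hv
    exact has_inter_points.2 ⟨L.has_S.2 ⟨h1, hp, h3⟩, hv⟩

/-- A subspace contains the affine line through one of its points parallel to one of its
lines. -/
theorem IsSubspace.has_of_parallel (hX : L.IsSubspace X) {u v e : V} (he : e ∈ L.T) (he0 : e ≠ 0)
    (hu : L.IsPt u) (huX : ∀ w ∈ Submodule.span K {u, e}, L.IsPt w → Has X w)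
    (hv : Has X v) (c : K) : Has X (v + c • e) := by
  have hv' := hX.isPt hv
  have hpe := L.proj_of_mem_T he
  have hqe : L.qf e = 0 := by rw [qf_apply, hpe, map_zero]
  have key : ∀ x, L.IsPt x → projDim (Submodule.span K {x, e}) = 1 ∧
      points (Submodule.span K {x, e}) ⊆ L.S₀ ∧
      L.S ∩ points (Submodule.span K {x, e}) = L.S ∩ points (Submodule.span K {x, e}) ∧
      Has (L.S ∩ points (Submodule.span K {x, e})) x ∧
      Projectivization.mk K e he0 ∈ points (Submodule.span K {x, e}) := by
    intro x hx
    refine ⟨projDim_span_pair (L.linearIndependent_pair_of_mem_T hx.ne he he0),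
      L.points_span_pair_subset_S₀ hx.mem (L.T_le_ambient he) hx.qf_eq hqe ?_, rfl,
      has_inter_points.2 ⟨L.has_S.2 hx, Submodule.subset_span (by simp)⟩,
      (mk_mem_points _).2 (Submodule.subset_span (by simp))⟩
    rw [L.bil_comm, bil_eq_zero_of_proj_eq_zero _ hpe]
  obtain ⟨a1, a2, a3, a4, a5⟩ := key u hu
  obtain ⟨b1, b2, b3, b4, b5⟩ := key v hv'
  refine subset_iff_has.1 (hX.parallel_subset (L.S ∩ points (Submodule.span K {v, e}))
    (L.S ∩ points (Submodule.span K {u, e}))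
    ⟨_, _, _, (mk_mem_points he0).2 he, ⟨b1, b2, b3, ⟨_, b4.2⟩, b5⟩, ⟨a1, a2, a3, ⟨_, a4.2⟩, a5⟩⟩
    (subset_iff_has.2 fun w hw => ?_) ⟨_, hv.2, b4.2⟩) _ ?_
  · obtain ⟨h1, h3⟩ := has_inter_points.1 hw
    exact huX w h3 (L.has_S.1 h1)
  · have hm : v + c • e ∈ Submodule.span K {v, e} :=
      Submodule.mem_span_pair.2 ⟨1, c, by simp⟩
    obtain ⟨h1, h3⟩ := L.qf_eq_zero_of_points_subset b2 hm
    refine has_inter_points.2 ⟨L.has_S.2 ⟨h1, ?_, h3⟩, hm⟩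
    simpa [hpe] using hv'.ne

/-- Every line of the Laguerre space spans its projective line. -/
theorem exists_pair_of_mem_lines [FiniteDimensional K V] {ℓ : Submodule K V}
    (hℓ : projDim ℓ = 1) (hS : points ℓ ⊆ L.S₀) (hne : (L.S ∩ points ℓ).Nonempty) {x : V}
    (hx : x ∈ ℓ) (hx0 : x ≠ 0) :
    ∃ y, Has (L.S ∩ points ℓ) y ∧ LinearIndependent K ![x, y] := by
  obtain ⟨p, hp⟩ := hne
  obtain ⟨h1, h3⟩ := has_inter_points.1 (has_rep.2 hp)
  have hp' := L.has_S.1 h1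
  by_cases hi : LinearIndependent K ![x, p.rep]
  · exact ⟨p.rep, has_rep.2 hp, hi⟩
  rw [LinearIndependent.pair_iff' hx0] at hi
  push Not at hi
  obtain ⟨c, hc⟩ := hi
  have hxp : L.proj x ≠ 0 := by
    intro h
    apply hp'.ne
    rw [← hc, map_smul, h, smul_zero]
  have hlt : Submodule.span K {x} < ℓ := by
    refine lt_of_le_of_ne ((Submodule.span_singleton_le_iff_mem _ _).2 hx) ?_
    rintro rfl
    rw [(projDim_eq_iff (n := 2) (by norm_num)), finrank_span_singleton hx0] at hℓ
    omega
  obtain ⟨y, hy, hyx⟩ := SetLike.exists_of_lt hlt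
  have hi : ∀ d : K, LinearIndependent K ![x, y + d • x] := by
    intro d
    rw [LinearIndependent.pair_iff' hx0]
    intro a ha
    apply hyx
    rw [Submodule.mem_span_singleton]
    exact ⟨a - d, by rw [sub_smul, ha]; simp⟩
  -- Here x lies outside T, being proportional to a point; if y lies in T, then y + x does not.
  by_cases hyp : L.proj y = 0
  · refine ⟨y + (1 : K) • x, ?_, hi 1⟩
    have hm : y + (1 : K) • x ∈ ℓ := ℓ.add_mem hy (ℓ.smul_mem _ hx)
    obtain ⟨h1, h3⟩ := L.qf_eq_zero_of_points_subset hS hm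
    exact has_inter_points.2 ⟨L.has_S.2 ⟨h1, by simpa [hyp] using hxp, h3⟩, hm⟩
  · refine ⟨y, ?_, by simpa using hi 0⟩
    obtain ⟨h1, h3⟩ := L.qf_eq_zero_of_points_subset hS hy
    exact has_inter_points.2 ⟨L.has_S.2 ⟨h1, hyp, h3⟩, hy⟩

/-- The plane spanned by three pairwise noncollinear points cuts out a cycle. -/
theorem isCycleOn_span_triple [FiniteDimensional K V] {u v p : V} (hu : L.IsPt u) (hv : L.IsPt v)
    (hp : L.IsPt p) (hi : LinearIndependent K ![u, v, p]) (huv : L.bil u v ≠ 0)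
    (hup : L.bil u p ≠ 0) (hvp : L.bil v p ≠ 0) :
    L.IsCycleOn (L.S ∩ points (Submodule.span K {u, v, p})) (Submodule.span K {u, v, p}) := by
  have h3 := finrank_span_triple_of_linearIndependent hi
  have hmem : ∀ x ∈ ({u, v, p} : Set V), L.IsPt x →
      Has (L.S ∩ points (Submodule.span K {u, v, p})) x := fun x hx hx' =>
    has_inter_points.2 ⟨L.has_S.2 hx', Submodule.subset_span hx⟩
  have iuv := L.linearIndependent_of_bil_ne_zero hu.qf_eq hv.qf_eq huv
  have iup := L.linearIndependent_of_bil_ne_zero hu.qf_eq hp.qf_eq hup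
  have ivp := L.linearIndependent_of_bil_ne_zero hv.qf_eq hp.qf_eq hvp
  refine ⟨(projDim_eq_iff (n := 3) (by norm_num)).2 h3, rfl,
    three_le_encard (hmem u (by simp) hu) (hmem v (by simp) hv) (hmem p (by simp) hp) iuv iup ivp, ?_⟩
  rintro k ⟨ℓ, hℓ, hS, rfl, hne⟩ hk
  have hℓ2 := (projDim_eq_iff (n := 2) (by norm_num)).1 hℓ
  have hle : ℓ ≤ Submodule.span K {u, v, p} := by
    have hk' : ∀ y, Has (L.S ∩ points ℓ) y → y ∈ Submodule.span K {u, v, p} := fun y hy =>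
      (has_inter_points.1 (subset_iff_has.1 hk y hy)).2
    obtain ⟨q, hq⟩ := hne
    obtain ⟨-, hx⟩ := has_inter_points.1 (has_rep.2 hq)
    obtain ⟨y, hy, hxy⟩ := exists_pair_of_mem_lines hℓ hS ⟨q, hq⟩ hx q.rep_nonzero
    rw [← eq_span_pair hℓ hx (has_inter_points.1 hy).2 hxy, Submodule.span_le]
    rintro z (rfl | rfl)
    · exact hk' _ (has_rep.2 hq)
    · exact hk' _ hy
  -- By dimension ℓ meets each of the secants uv, up, vp, and a secant is singular only at its two
  -- ends. So ℓ contains two of the three points, which would then be orthogonal.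
  have key : ∀ x y : V, L.IsPt x → L.IsPt y → L.bil x y ≠ 0 → x ∈ ({u, v, p} : Set V) →
      y ∈ ({u, v, p} : Set V) → x ∈ ℓ ∨ y ∈ ℓ := by
    intro x y hx hy hxy hxm hym
    obtain ⟨w, hwℓ, hw, hw0⟩ := exists_ne_zero_mem_inf (P := Submodule.span K {x, y}) hle
      (Submodule.span_mono (Set.insert_subset hxm (Set.singleton_subset_iff.2 hym))) (by
        rw [h3, hℓ2, finrank_span_pair_of_linearIndependent
          (L.linearIndependent_of_bil_ne_zero hx.qf_eq hy.qf_eq hxy)]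
        norm_num)
    obtain ⟨a, b, rfl⟩ := Submodule.mem_span_pair.1 hw
    have hq := (L.qf_eq_zero_of_points_subset hS hwℓ).2
    rw [qf_add_smul, qf_smul, hx.qf_eq, hy.qf_eq] at hq
    have hab : b * a = 0 := by simpa [hxy, mul_eq_zero] using hq
    rcases mul_eq_zero.1 hab with rfl | rfl
    · have ha : a ≠ 0 := by rintro rfl; simp at hw0
      exact Or.inl (by simpa [ha] using (ℓ.smul_mem_iff ha).1 (by simpa using hwℓ))
    · have hb : b ≠ 0 := by rintro rfl; simp at hw0
      exact Or.inr (by simpa [hb] using (ℓ.smul_mem_iff hb).1 (by simpa using hwℓ))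
  have h1 := key u v hu hv huv (by simp) (by simp)
  have h4 := key u p hu hp hup (by simp) (by simp)
  have h5 := key v p hv hp hvp (by simp) (by simp)
  have h6 := fun {x y : V} (hx : x ∈ ℓ) (hy : y ∈ ℓ) => L.bil_eq_zero_of_points_subset hS hx hy
  rcases h1 with h1 | h1
  · rcases h5 with h5 | h5
    · exact huv (h6 h1 h5)
    · exact hup (h6 h1 h5)
  · rcases h4 with h4 | h4
    · exact huv (h6 h4 h1)
    · exact hvp (h6 h1 h4)

theorem IsSubspace.has_of_cycle [FiniteDimensional K V] (hX : L.IsSubspace X) {u v p r : V}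
    (hu : Has X u) (hv : Has X v) (hp : Has X p) (hi : LinearIndependent K ![u, v, p])
    (huv : L.bil u v ≠ 0) (hup : L.bil u p ≠ 0) (hvp : L.bil v p ≠ 0)
    (hr : r ∈ Submodule.span K {u, v, p}) (hr' : L.IsPt r) : Has X r := by
  have hu' := hX.isPt hu
  have hv' := hX.isPt hv
  have hp' := hX.isPt hp
  have hmem : ∀ x ∈ ({u, v, p} : Set V), Has X x →
      Has ((L.S ∩ points (Submodule.span K {u, v, p})) ∩ X) x := fun x hx hx' =>
    ⟨hx'.1, (has_inter_points.2 ⟨L.has_S.2 (hX.isPt hx'), Submodule.subset_span hx⟩).2, hx'.2⟩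
  refine subset_iff_has.1 (hX.cycle_subset _
    ⟨_, isCycleOn_span_triple hu' hv' hp' hi huv hup hvp⟩ ?_) r
    (has_inter_points.2 ⟨L.has_S.2 hr', hr⟩)
  exact three_le_encard (hmem u (by simp) hu) (hmem v (by simp) hv) (hmem p (by simp) hp)
    (L.linearIndependent_of_bil_ne_zero hu'.qf_eq hv'.qf_eq huv)
    (L.linearIndependent_of_bil_ne_zero hu'.qf_eq hp'.qf_eq hup)
    (L.linearIndependent_of_bil_ne_zero hv'.qf_eq hp'.qf_eq hvp)

/-- The section of a subspace by a degenerate plane through a noncollinear pair `u`, `v` and a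
point `p` collinear with `u`. -/
theorem IsSubspace.has_of_degenerate (hX : L.IsSubspace X) {u v p : V} {α β : K}
    (hu : Has X u) (hv : Has X v) (hp : Has X p) (hi : p ∉ Submodule.span K {u, v})
    (hup : L.bil u p = 0) (hβ : β ≠ 0)
    (hr : L.IsPt (p + (α • u + β • v))) : Has X (p + (α • u + β • v)) := by
  have hu' := hX.isPt hu
  have hv' := hX.isPt hv
  have hp' := hX.isPt hp
  -- Singularity of r, after division by β, gives this value; it makes z = p + αu orthogonal to v.
  have hpv : L.bil p v = - (α * L.bil u v) := by
    have h := hr.qf_eq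
    rw [qf_add, hp'.qf_eq, qf_add_smul, qf_smul, hu'.qf_eq, hv'.qf_eq] at h
    simp only [map_add, map_smul, LinearMap.smul_apply, smul_eq_mul, L.bil_comm p u, hup] at h
    have : β * (L.bil p v + α * L.bil u v) = 0 := by linear_combination h
    linear_combination (mul_eq_zero.1 this).resolve_left hβ
  set z := p + α • u with hz
  have hzv : L.bil z v = 0 := by
    simp [hz, hpv]
  have hzE : z ∈ L.ambient := L.ambient.add_mem hp'.mem (L.ambient.smul_mem _ hu'.mem)
  have hzi : ∀ c : K, z ≠ c • v := by
    intro c h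
    apply hi
    refine Submodule.mem_span_pair.2 ⟨-α, c, ?_⟩
    rw [← h, hz]
    simp
  have hz0 : z ≠ 0 := fun h => hzi 0 (by simpa using h)
  have ipu : LinearIndependent K ![u, p] := by
    rw [LinearIndependent.pair_iff' hu'.ne_zero]
    rintro a rfl
    exact hi (Submodule.mem_span_pair.2 ⟨a, 0, by simp⟩)
  have hline : ∀ w ∈ Submodule.span K {u, z}, L.IsPt w → Has X w := by
    intro w hw hw'
    refine hX.has_of_line hu hp ipu hup ?_ hw'.ne
    obtain ⟨a, b, rfl⟩ := Submodule.mem_span_pair.1 hw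
    refine Submodule.mem_span_pair.2 ⟨a + b * α, b, ?_⟩
    rw [hz]
    module
  have hrz : p + (α • u + β • v) = z + β • v := by rw [hz, add_assoc]
  rw [hrz] at hr ⊢
  -- If z lies in T, the line uz is an affine line in X, and r = z + βv lies on its parallel through
  -- v. Otherwise z is a point of the line up, and r lies on the line zv.
  by_cases hzp : L.proj z = 0
  · have hzT := (L.proj_eq_zero_iff hzE).1 hzp
    have := (hX.has_of_parallel hzT hz0 hu' hline hv β⁻¹).smul hβ
    convert this using 1
    rw [smul_add, smul_smul, mul_inv_cancel₀ hβ, one_smul, add_comm]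
  · have hqz : L.qf z = 0 := by
      rw [hz, qf_add_smul, hp'.qf_eq, hu'.qf_eq, L.bil_comm, hup]; simp
    have hzX : Has X z := hline z (Submodule.subset_span (by simp)) ⟨hzE, hzp, hqz⟩
    refine hX.has_of_line hv hzX ?_ (by rw [L.bil_comm, hzv]) ?_ hr.ne
    · rw [LinearIndependent.pair_iff' hv'.ne_zero]
      exact fun a ha => hzi a ha.symm
    · exact Submodule.mem_span_pair.2 ⟨β, 1, by rw [one_smul, add_comm]⟩

/-- The plane degenerates if p is orthogonal to u or to v; the second case exchanges u and v, so
both coefficients must be nonzero. If p is orthogonal to neither, the plane cuts out a cycle. -/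
theorem IsSubspace.has_of_secant [FiniteDimensional K V] (hX : L.IsSubspace X) {u v p : V}
    {α β : K} (hu : Has X u) (hv : Has X v) (hp : Has X p) (hi : p ∉ Submodule.span K {u, v})
    (huv : L.bil u v ≠ 0) (hα : α ≠ 0) (hβ : β ≠ 0)
    (hr : L.IsPt (p + (α • u + β • v))) : Has X (p + (α • u + β • v)) := by
  by_cases hup : L.bil u p = 0
  · exact hX.has_of_degenerate hu hv hp hi hup hβ hr
  by_cases hvp : L.bil v p = 0
  · rw [add_comm (α • u)] at hr ⊢
    exact hX.has_of_degenerate hv hu hp (by rwa [Set.pair_comm]) hvp hα hr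
  refine hX.has_of_cycle hu hv hp ?_ huv hup hvp ?_ hr
  · exact linearIndependent_triple_of_notMem_span
      (L.linearIndependent_of_bil_ne_zero (hX.isPt hu).qf_eq (hX.isPt hv).qf_eq huv) hi
  · exact Submodule.mem_span_triple.2 ⟨α, β, 1, by module⟩

/-! ### Every subspace is a linear section. -/

/-- A nonsingular vector of a subspace spanned by singular vectors lies on a secant. -/
theorem exists_secant (h2 : (2 : K) ≠ 0) {M : Submodule K V} {s : Set V}
    (hM : M = Submodule.span K s) (hs : ∀ u ∈ s, L.IsPt u) {m : V} (hm : m ∈ M)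
    (hq : L.qf m ≠ 0) :
    ∃ u v : V, ∃ α β : K, u ∈ M ∧ v ∈ M ∧ L.IsPt u ∧ L.IsPt v ∧ L.bil u v ≠ 0 ∧ α ≠ 0 ∧ β ≠ 0 ∧
      m = α • u + β • v := by
  have hE : M ≤ L.ambient := by
    rw [hM, Submodule.span_le]
    exact fun u hu => (hs u hu).mem
  -- Were m orthogonal to all the spanning points, it would be orthogonal to itself, against `bil m
  -- m = 2 * qf m`.
  obtain ⟨u, hu, hum⟩ : ∃ u ∈ s, L.bil u m ≠ 0 := by
    by_contra! h
    have h1 : M ≤ LinearMap.ker (L.bil m) := by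
      rw [hM, Submodule.span_le]
      exact fun u hu => by simpa [L.bil_comm m u] using h u hu
    have h3 := h1 hm
    rw [LinearMap.mem_ker, bil_self] at h3
    exact mul_ne_zero h2 hq h3
  have huM : u ∈ M := hM ▸ Submodule.subset_span hu
  -- The nonzero root of `qf (u + c • m) = c * (c * qf m + bil u m)`: the second singular point on
  -- the line through u and m.
  set c := -(L.bil u m / L.qf m) with hc
  have hc0 : c ≠ 0 := neg_ne_zero.2 (div_ne_zero hum hq)
  have hcq : c * L.qf m = - L.bil u m := by rw [hc]; field_simp
  have hvM : u + c • m ∈ M := M.add_mem huM (M.smul_mem _ hm)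
  have hvq : L.qf (u + c • m) = 0 := by
    rw [qf_add_smul, (hs u hu).qf_eq]
    linear_combination c * hcq
  have hvm : L.bil (u + c • m) m = - L.bil u m := by
    simp only [map_add, map_smul, LinearMap.add_apply, LinearMap.smul_apply, bil_self, smul_eq_mul]
    linear_combination 2 * hcq
  refine ⟨u, u + c • m, -c⁻¹, c⁻¹, huM, hvM, hs u hu,
    IsPt.of_bil L (hE hvM) hvq (w := m) (by rw [hvm]; exact neg_ne_zero.2 hum), ?_,
    neg_ne_zero.2 (inv_ne_zero hc0), inv_ne_zero hc0, ?_⟩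
  · simp [bil_self, (hs u hu).qf_eq, hc0, hum]
  · rw [smul_add, smul_smul, inv_mul_cancel₀ hc0, one_smul]
    module

/-- The extension step for the maximal M. That M is spanned by points is essential: it supplies a
line of X through each vector of M in T, and a secant through each nonsingular vector of M. -/
theorem IsSubspace.has_of_mem_sup [FiniteDimensional K V] (h2 : (2 : K) ≠ 0)
    (hX : L.IsSubspace X) {M : Submodule K V} {s : Set V} (hM : M = Submodule.span K s)
    (hs : ∀ u ∈ s, L.IsPt u) (hMX : ∀ v ∈ M, L.IsPt v → Has X v) {p : V} (hp : Has X p)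
    {r : V} (hr : r ∈ M ⊔ Submodule.span K {p}) (hr' : L.IsPt r) : Has X r := by
  by_cases hpM : p ∈ M
  · rw [sup_eq_left.2 ((Submodule.span_singleton_le_iff_mem _ _).2 hpM)] at hr
    exact hMX r hr hr'
  have hE : M ≤ L.ambient := by
    rw [hM, Submodule.span_le]
    exact fun u hu => (hs u hu).mem
  have key : ∀ m ∈ M, L.IsPt (p + m) → Has X (p + m) := by
    intro m hm hpm
    by_cases hm0 : m = 0
    · simpa [hm0] using hp
    have hp' := hX.isPt hp
    by_cases hmT : L.proj m = 0
    · obtain ⟨u, hu⟩ : s.Nonempty := by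
        rw [Set.nonempty_iff_ne_empty]
        rintro rfl
        rw [hM, Submodule.span_empty] at hm
        exact hm0 hm
      have huM : u ∈ M := hM ▸ Submodule.subset_span hu
      have := hX.has_of_parallel ((L.proj_eq_zero_iff (hE hm)).1 hmT) hm0 (hs u hu)
        (fun w hw hw' => hMX w (Submodule.span_le.2 (by
          rintro x (rfl | rfl) <;> assumption) hw) hw') hp 1
      simpa using this
    by_cases hmq : L.qf m = 0
    · have hmX := hMX m hm ⟨hE hm, hmT, hmq⟩
      refine hX.has_of_line hp hmX ?_ ?_ (Submodule.mem_span_pair.2 ⟨1, 1, by simp⟩) hpm.ne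
      · rw [LinearIndependent.pair_symm_iff, LinearIndependent.pair_iff' hm0]
        rintro a rfl
        exact hpM (M.smul_mem _ hm)
      · have := hpm.qf_eq
        rw [qf_add, hp'.qf_eq, hmq] at this
        simpa using this
    · obtain ⟨u, v, α, β, hu, hv, hu', hv', huv, hα, hβ, rfl⟩ := exists_secant h2 hM hs hm hmq
      refine hX.has_of_secant (hMX u hu hu') (hMX v hv hv') hp (fun h => hpM ?_) huv hα hβ hpm
      exact Submodule.span_le.2 (by rintro x (rfl | rfl) <;> assumption) h
  obtain ⟨m, hm, y, hy, rfl⟩ := Submodule.mem_sup.1 hr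
  obtain ⟨c, rfl⟩ := Submodule.mem_span_singleton.1 hy
  by_cases hc : c = 0
  · subst hc
    rw [zero_smul, add_zero] at hr' ⊢
    exact hMX m hm hr'
  have hrw : m + c • p = c • (p + c⁻¹ • m) := by
    rw [smul_add, smul_smul, mul_inv_cancel₀ hc, one_smul, add_comm]
  have hpt : L.IsPt (p + c⁻¹ • m) := by
    rw [hrw] at hr'
    have := L.has_S.1 ((L.has_S.2 hr').smul (inv_ne_zero hc))
    rwa [smul_smul, inv_mul_cancel₀ hc, one_smul] at this
  rw [hrw]
  exact (key _ (M.smul_mem _ hm) hpt).smul hc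

/-- Every subspace of a Laguerre space is the section of `S` by a projective subspace. -/
theorem IsSubspace.exists_eq_inter_points [FiniteDimensional K V] (h2 : (2 : K) ≠ 0)
    (hX : L.IsSubspace X) : ∃ M ≤ L.ambient, X = L.S ∩ points M := by
  let P : Submodule K V → Prop := fun M => ∃ s : Set V, M = Submodule.span K s ∧
    (∀ u ∈ s, L.IsPt u) ∧ ∀ v ∈ M, L.IsPt v → Has X v
  have h0 : P ⊥ := ⟨∅, by simp, by simp, fun v hv hv' => absurd hv hv'.ne_zero⟩
  obtain ⟨M, hM⟩ := WellFounded.has_min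
    (r := ((· > ·) : Submodule K V → Submodule K V → Prop)) wellFounded_gt {M | P M} ⟨⊥, h0⟩
  obtain ⟨⟨s, hMs, hs, hMX⟩, hmax⟩ := hM
  refine ⟨M, ?_, Set.Subset.antisymm (subset_iff_has.2 fun p hp => ?_)
    (subset_iff_has.2 fun v hv => ?_)⟩
  · rw [hMs, Submodule.span_le]
    exact fun u hu => (hs u hu).mem
  · refine has_inter_points.2 ⟨L.has_S.2 (hX.isPt hp), ?_⟩
    by_contra hpM
    refine hmax (M ⊔ Submodule.span K {p}) ⟨s ∪ {p}, ?_, ?_, ?_⟩ ?_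
    · rw [Submodule.span_union, hMs]
    · rintro u (hu | rfl)
      exacts [hs u hu, hX.isPt hp]
    · exact fun v hv hv' => hX.has_of_mem_sup h2 hMs hs hMX hp hv hv'
    · refine lt_of_le_of_ne le_sup_left fun h => hpM ?_
      rw [h]
      exact Submodule.mem_sup_right (Submodule.mem_span_singleton_self p)
  · obtain ⟨h1, h3⟩ := has_inter_points.1 hv
    exact hMX v h3 (L.has_S.1 h1)

/-! ### Linear sections are subspaces; reduction to hyperplanes. -/

/-- Three points of a cycle span its plane. -/
theorem IsCycleOn.le_of_three [FiniteDimensional K V] {A : Set (ℙ K V)} {α H : Submodule K V}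
    (hA : L.IsCycleOn A α) {u v w : V} (hu : Has A u) (hv : Has A v) (hw : Has A w)
    (huv : LinearIndependent K ![u, v]) (huw : LinearIndependent K ![u, w])
    (hvw : LinearIndependent K ![v, w]) (huH : u ∈ H) (hvH : v ∈ H) (hwH : w ∈ H) : α ≤ H := by
  obtain ⟨hα, rfl, -, hno⟩ := hA
  obtain ⟨hu, huα⟩ := has_inter_points.1 hu
  obtain ⟨hv, hvα⟩ := has_inter_points.1 hv
  obtain ⟨hw, hwα⟩ := has_inter_points.1 hw
  -- Three distinct singular points on one projective line force it to lie on the cone, so the cycle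
  -- would contain a line.
  by_cases hi : w ∈ Submodule.span K {u, v}
  · exfalso
    have hu' := L.has_S.1 hu
    have hv' := L.has_S.1 hv
    have hw' := L.has_S.1 hw
    have hb : L.bil u v = 0 := by
      obtain ⟨a, b, rfl⟩ := Submodule.mem_span_pair.1 hi
      have h := hw'.qf_eq
      rw [qf_add_smul, qf_smul, hu'.qf_eq, hv'.qf_eq] at h
      have ha : a ≠ 0 := by
        rintro rfl
        have := (LinearIndependent.pair_iff.1 hvw) b (-1) (by simp)
        simp at this
      have hb : b ≠ 0 := by
        rintro rfl
        have := (LinearIndependent.pair_iff.1 huw) a (-1) (by simp)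
        simp at this
      simpa [ha, hb] using h
    refine hno _ ⟨_, projDim_span_pair huv, L.points_span_pair_subset_S₀ hu'.mem hv'.mem
      hu'.qf_eq hv'.qf_eq hb, rfl, ?_⟩ (Set.inter_subset_inter_right _ (points_mono ?_))
    · exact ⟨_, (has_inter_points.2 ⟨hu, Submodule.subset_span (by simp)⟩).2⟩
    · rw [Submodule.span_le]
      rintro x (rfl | rfl) <;> assumption
  · rw [← eq_span_triple hα huα hvα hwα (linearIndependent_triple_of_notMem_span huv hi),
      Submodule.span_le]
    rintro x (rfl | rfl | rfl) <;> assumption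

/-- Every section of `S` by a projective subspace is a subspace of the Laguerre space. -/
theorem isSubspace_inter_points [FiniteDimensional K V] (H : Submodule K V) :
    L.IsSubspace (L.S ∩ points H) where
  subset := Set.inter_subset_left
  line_subset := by
    rintro k ⟨ℓ, hℓ, -, rfl, -⟩ h
    obtain ⟨u, w, hu, hw, hi⟩ := exists_pair_of_two_le_encard h
    have hsub : ℓ ≤ H := by
      rw [← eq_span_pair hℓ ((mk_mem_points hu.1).1 hu.2.1.2) ((mk_mem_points hw.1).1 hw.2.1.2) hi,
        Submodule.span_le]
      rintro x (rfl | rfl)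
      exacts [(mk_mem_points hu.1).1 hu.2.2.2, (mk_mem_points hw.1).1 hw.2.2.2]
    exact Set.inter_subset_inter_right _ (points_mono hsub)
  parallel_subset := by
    rintro k m ⟨ℓ, ℓ', e, heT, ⟨hℓ, -, rfl, -, heℓ⟩, hℓ', hS', rfl, hne', heℓ'⟩ hm ⟨a, ha⟩
    -- The line m contains points y and y + e, both in H, hence their difference is in H.
    have he : e.rep ∈ H := by
      obtain ⟨y, hy, hi⟩ := exists_pair_of_mem_lines hℓ' hS' hne' (mem_points_iff.1 heℓ')
        e.rep_nonzero
      have hyS := L.has_S.1 (has_inter_points.1 hy).1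
      have hyl := (has_inter_points.1 hy).2
      have hmem : y + e.rep ∈ ℓ' := ℓ'.add_mem hyl (mem_points_iff.1 heℓ')
      obtain ⟨h1, h3⟩ := L.qf_eq_zero_of_points_subset hS' hmem
      have hye : Has (L.S ∩ points ℓ') (y + e.rep) :=
        has_inter_points.2 ⟨L.has_S.2 ⟨h1, by
          simpa [L.proj_of_mem_T (mem_points_iff.1 heT)] using hyS.ne, h3⟩, hmem⟩
      have hy1 := (has_inter_points.1 (subset_iff_has.1 hm _ hy)).2
      have hy2 := (has_inter_points.1 (subset_iff_has.1 hm _ hye)).2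
      simpa using H.sub_mem hy2 hy1
    obtain ⟨⟨haS, haH⟩, -, haℓ⟩ := ha
    have haS' := L.has_S.1 (has_rep.2 haS)
    have hi := L.linearIndependent_pair_of_mem_T haS'.ne (mem_points_iff.1 heT) e.rep_nonzero
    have hsub : ℓ ≤ H := by
      rw [← eq_span_pair hℓ (mem_points_iff.1 haℓ) (mem_points_iff.1 heℓ) hi, Submodule.span_le]
      rintro x (rfl | rfl)
      exacts [mem_points_iff.1 haH, he]
    exact Set.inter_subset_inter_right _ (points_mono hsub)
  cycle_subset := by
    rintro A ⟨α, hA⟩ h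
    obtain ⟨u, v, w, hu, hv, hw, huv, huw, hvw⟩ := exists_triple_of_three_le_encard h
    have hle := hA.le_of_three (H := H) ⟨hu.1, hu.2.1⟩ ⟨hv.1, hv.2.1⟩ ⟨hw.1, hw.2.1⟩ huv huw hvw
      ((mk_mem_points hu.1).1 hu.2.2.2) ((mk_mem_points hv.1).1 hv.2.2.2)
      ((mk_mem_points hw.1).1 hw.2.2.2)
    rw [hA.2.1]
    exact Set.inter_subset_inter_right _ (points_mono hle)
  tangent_subset := by
    rintro A C ⟨α, β, ℓ, p, hA, hC, hℓ, hℓα, hℓβ, hAp, hCp⟩ hCX h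
    have hβ : β ≤ H := by
      obtain ⟨u, v, w, hu, hv, hw, huv, huw, hvw⟩ := exists_triple_of_three_le_encard hC.2.2.1
      exact hC.le_of_three hu hv hw huv huw hvw
        (has_inter_points.1 (subset_iff_has.1 hCX _ hu)).2
        (has_inter_points.1 (subset_iff_has.1 hCX _ hv)).2
        (has_inter_points.1 (subset_iff_has.1 hCX _ hw)).2
    -- The tangent ℓ lies in H with the plane of C and meets A only in p. A second point r of A in H
    -- is therefore off ℓ, and ℓ and r span the plane of A.
    obtain ⟨r, hr, hrp⟩ := Set.exists_ne_of_one_lt_encard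
      (lt_of_lt_of_le (by norm_num) h) p
    have hrℓ : r.rep ∉ ℓ := by
      intro hmem
      exact hrp (Set.mem_singleton_iff.1 (hAp ▸ ⟨hr.2, mem_points_iff.2 hmem⟩))
    have hrA := hr.2
    have hα : ℓ ⊔ Submodule.span K {r.rep} = α := by
      refine Submodule.eq_of_le_of_finrank_eq (sup_le hℓα ?_) ?_
      · rw [Submodule.span_singleton_le_iff_mem]
        rw [hA.2.1] at hrA
        exact mem_points_iff.1 hrA.2
      · rw [finrank_sup_span_singleton_of_notMem hrℓ,
          (projDim_eq_iff (n := 3) (by norm_num)).1 hA.1,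
          (projDim_eq_iff (n := 2) (by norm_num)).1 hℓ]
    have hle : α ≤ H := by
      rw [← hα]
      exact sup_le (hℓβ.trans hβ)
        ((Submodule.span_singleton_le_iff_mem _ _).2 (mem_points_iff.1 hr.1.2))
    rw [hA.2.1]
    exact Set.inter_subset_inter_right _ (points_mono hle)

/-- The points of the Laguerre space span its ambient projective space. -/
theorem ambient_le_of_S_subset (h2 : (2 : K) ≠ 0) {H : Submodule K V} (h : L.S ⊆ points H) :
    L.ambient ≤ H := by
  have hH : ∀ v, L.IsPt v → v ∈ H := fun v hv =>
    (mk_mem_points hv.ne_zero).1 (h ((L.mk_mem_S hv.ne_zero).2 hv))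
  obtain ⟨x, hxB, hx0, hxq⟩ := L.exists_singular
  have hx : L.IsPt x := ⟨L.B_le_ambient hxB, by
    rw [L.proj_of_mem_B hxB]
    exact fun h => hx0 (congrArg Subtype.val h), hxq⟩
  -- Some translate of y by a multiple of x is singular, hence a point of S.
  have key : ∀ y ∈ L.B, L.bil x y ≠ 0 → y ∈ H := by
    intro y hy hxy
    have hyx : L.bil y x ≠ 0 := by rwa [L.bil_comm]
    have hpt : L.IsPt (y + (-(L.qf y / L.bil y x)) • x) := by
      refine IsPt.of_bil L (w := x) (L.ambient.add_mem (L.B_le_ambient hy)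
        (L.ambient.smul_mem _ hx.mem)) ?_ ?_
      · rw [qf_add_smul, hxq]
        field_simp
        ring
      · simpa [bil_self, hxq] using hyx
    have := H.sub_mem (hH _ hpt) (H.smul_mem (-(L.qf y / L.bil y x)) (hH x hx))
    simpa using this
  obtain ⟨y₀, hy₀, hxy₀⟩ : ∃ y ∈ L.B, L.bil x y ≠ 0 := by
    by_contra! hc
    exact hx0 (L.eq_zero_of_bil_eq_zero h2 hxB hc)
  refine sup_le (fun e he => ?_) (fun y hy => ?_)
  · have hpe := L.proj_of_mem_T he
    have hpt : L.IsPt (x + e) := ⟨L.ambient.add_mem hx.mem (L.T_le_ambient he), by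
      simpa [hpe] using hx.ne, by
      rw [qf_apply, map_add, hpe, add_zero, ← qf_apply, hxq]⟩
    simpa using H.sub_mem (hH _ hpt) (hH x hx)
  -- A vector orthogonal to x is a difference of two vectors that are not.
  · by_cases hxy : L.bil x y = 0
    · have h1 := key (y + y₀) (L.B.add_mem hy hy₀) (by simpa [hxy] using hxy₀)
      simpa using H.sub_mem h1 (key y₀ hy₀ hxy₀)
    · exact key y hy hxy

/-- A maximal proper subspace is a hyperplane section. -/
theorem IsMaximalProperSubspace.exists_eq_inter_ker [FiniteDimensional K V] (h2 : (2 : K) ≠ 0)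
    (hX : L.IsMaximalProperSubspace X) : ∃ f : V →ₗ[K] K, (∃ v ∈ L.ambient, f v ≠ 0) ∧
      X = L.S ∩ points (LinearMap.ker f) := by
  obtain ⟨⟨hsub, hne⟩, hmax⟩ := hX
  obtain ⟨M, hM, hXM⟩ := hsub.exists_eq_inter_points h2
  obtain ⟨v, hv, hvM⟩ : ∃ v ∈ L.ambient, v ∉ M := by
    by_contra! hc
    refine hne (hXM.trans (Set.inter_eq_left.2 (subset_iff_has.2 fun w hw => ?_)))
    have hw' := L.has_S.1 hw
    exact ⟨hw'.ne_zero, (mk_mem_points _).2 (hc w hw'.mem)⟩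
  obtain ⟨f, hfv, hf⟩ := Submodule.exists_le_ker_of_notMem hvM
  refine ⟨f, ⟨v, hv, hfv⟩, ?_⟩
  have hle : X ≤ L.S ∩ points (LinearMap.ker f) := by
    rw [hXM]
    exact Set.inter_subset_inter_right _ (points_mono hf)
  -- The hyperplane section is itself a proper subspace, because S spans the ambient space;
  -- maximality gives equality.
  refine le_antisymm hle (hmax ⟨isSubspace_inter_points _, fun h => hfv ?_⟩ hle)
  exact ambient_le_of_S_subset h2 (Set.inter_eq_left.1 h) hv

/-! ### Recognising quadrics, indices and affine cones. -/

theorem isPt_of_points_subset {M : Submodule K V} (h : points M ⊆ L.S) {v : V} (hv : v ∈ M)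
    (h0 : v ≠ 0) : L.IsPt v :=
  (L.mk_mem_S h0).1 (h ((mk_mem_points h0).2 hv))

theorem points_subset_S {M : Submodule K V} (h : ∀ v ∈ M, v ≠ 0 → L.IsPt v) :
    points M ⊆ L.S := by
  intro p hp
  rw [← p.mk_rep] at hp ⊢
  exact (L.mk_mem_S _).2 (h _ ((mk_mem_points _).1 hp) p.rep_nonzero)

theorem hasIndex_inter_points {U : Submodule K V} {w : ℤ}
    (h1 : ∃ M ≤ U, points M ⊆ L.S ∧ projDim M = w)
    (h2 : ∀ M ≤ U, points M ⊆ L.S → projDim M ≤ w) : HasIndex (L.S ∩ points U) w := by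
  constructor
  · obtain ⟨M, hMU, hMS, hM⟩ := h1
    exact ⟨M, Set.subset_inter hMS (points_mono hMU), hM⟩
  · rintro k ⟨M, hM, rfl⟩
    exact h2 M (points_subset_points.1 (hM.trans Set.inter_subset_right))
      (hM.trans Set.inter_subset_left)

/-- Sections of `S` by subspaces on which the form is nondegenerate are quadrics. -/
theorem isSubquadric_inter_points (h2 : (2 : K) ≠ 0) {U : Submodule K V} {d w : ℤ}
    (hU : U ≤ L.ambient) (hnd : ∀ z ∈ U, (∀ u ∈ U, L.bil z u = 0) → z = 0)
    (hd : projDim U = d + 1) (hw : HasIndex (L.S ∩ points U) w) (hw0 : 0 ≤ w) :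
    L.IsSubquadric U (L.S ∩ points U) d w := by
  refine ⟨hd, rfl, ?_, ⟨L.qf.comp U.subtype, ?_, ?_⟩, hw⟩
  · obtain ⟨M, hM, hMw⟩ := hw.1
    have hM0 : M ≠ ⊥ := by
      rintro rfl
      simp [projDim] at hMw
      omega
    obtain ⟨v, hv, h0⟩ := Submodule.exists_mem_ne_zero_of_ne_bot hM0
    exact ⟨_, hM ((mk_mem_points h0).2 hv)⟩
  · have := invertibleOfNonzero h2
    rw [QuadraticMap.nondegenerate_iff_radical_eq_bot, Submodule.eq_bot_iff]
    rintro z ⟨-, hz⟩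
    refine Subtype.ext (hnd z z.2 fun u hu => ?_)
    have := LinearMap.congr_fun hz ⟨u, hu⟩
    simpa [QuadraticMap.polar, bil] using this
  · have hiff : ∀ v : V, ∀ h0 : v ≠ 0, Projectivization.mk K v h0 ∈ L.S ∩ points U ↔
        Projectivization.mk K v h0 ∈ quadricPoints U (L.qf.comp U.subtype) := by
      intro v h0
      rw [Set.mem_inter_iff, mk_mem_S, mk_mem_points, mk_mem_quadricPoints]
      -- A vector of U in T would be orthogonal to all of U, so nondegeneracy keeps U disjoint from
      -- T.
      refine ⟨fun h => ⟨h.2, h.1.qf_eq⟩, fun ⟨h, hq⟩ => ⟨⟨hU h, fun hp => h0 ?_, hq⟩, h⟩⟩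
      exact hnd v h fun u _ => L.bil_eq_zero_of_proj_eq_zero hp u
    ext p
    simpa only [p.mk_rep] using hiff p.rep p.rep_nonzero

/-- Adding a vector of T' changes neither projection nor form, so the cone over D stays in S off T';
`h` provides the other inclusion. -/
theorem inter_points_eq_affineCone {T' H : Submodule K V} {D : Set (ℙ K V)} (hT' : T' ≤ L.T)
    (hH : T' ≤ H) (hHT : ∀ v ∈ H, v ∈ L.T → v ∈ T') (hD : D ⊆ L.S ∩ points H)
    (h : ∀ v ∈ H, L.IsPt v → ∃ w ∈ T', ∃ u, Has D u ∧ v = w + u) :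
    L.S ∩ points H = cone T' D \ points T' := by
  have hiff : ∀ v : V, ∀ h0 : v ≠ 0, Projectivization.mk K v h0 ∈ L.S ∩ points H ↔
      Projectivization.mk K v h0 ∈ cone T' D \ points T' := by
    intro v h0
    rw [Set.mem_inter_iff, mk_mem_S, mk_mem_points, Set.mem_sdiff, mk_mem_cone, mk_mem_points]
    constructor
    · rintro ⟨hv, hvH⟩
      obtain ⟨w, hw, u, ⟨hu0, hu⟩, rfl⟩ := h v hvH hv
      exact ⟨⟨u, hu0, hu, w, 1, hw, by simp⟩, fun hT => hv.ne (L.proj_of_mem_T (hT' hT))⟩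
    · rintro ⟨⟨x, hx0, hx, w, c, hw, rfl⟩, hn⟩
      obtain ⟨hxS, hxH⟩ := has_inter_points.1 (subset_iff_has.1 hD x ⟨hx0, hx⟩)
      have hxS := L.has_S.1 hxS
      have hvH : w + c • x ∈ H := H.add_mem (hH hw) (H.smul_mem _ hxH)
      have hvE : w + c • x ∈ L.ambient :=
        L.ambient.add_mem (L.T_le_ambient (hT' hw)) (L.ambient.smul_mem _ hxS.mem)
      refine ⟨⟨hvE, fun hp => hn (hHT _ hvH ((L.proj_eq_zero_iff hvE).1 hp)), ?_⟩, hvH⟩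
      rw [qf_apply, map_add, L.proj_of_mem_T (hT' hw), zero_add, ← qf_apply, qf_smul, hxS.qf_eq,
        mul_zero]
  ext p
  simpa only [p.mk_rep] using hiff p.rep p.rep_nonzero

variable {t : ℤ}

theorem isPt_of_mem_B {v : V} (hv : v ∈ L.B) (h0 : v ≠ 0) (hq : L.qf v = 0) : L.IsPt v :=
  ⟨L.B_le_ambient hv, by
    rw [L.proj_of_mem_B hv]
    exact fun h => h0 (congrArg Subtype.val h), hq⟩

theorem points_subset_quadric_iff {M : Submodule K V} :
    points M ⊆ L.quadric ↔ M ≤ L.B ∧ points M ⊆ L.S := by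
  constructor
  · intro h
    have h' : ∀ v ∈ M, v ≠ 0 → v ∈ L.B ∧ L.qf v = 0 := fun v hv h0 =>
      (L.mk_mem_quadric h0).1 (h ((mk_mem_points h0).2 hv))
    refine ⟨fun v hv => ?_, points_subset_S fun v hv h0 =>
      isPt_of_mem_B (h' v hv h0).1 h0 (h' v hv h0).2⟩
    by_cases h0 : v = 0
    · simp [h0]
    · exact (h' v hv h0).1
  · rintro ⟨hB, hS⟩ p hp
    rw [← p.mk_rep] at hp ⊢
    have hm := (mk_mem_points _).1 hp
    exact (L.mk_mem_quadric _).2 ⟨hB hm, (isPt_of_points_subset hS hm p.rep_nonzero).qf_eq⟩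

theorem exists_projDim_eq_index (ht : HasIndex L.quadric t) :
    ∃ M ≤ L.B, points M ⊆ L.S ∧ projDim M = t := by
  obtain ⟨M, hM, hMt⟩ := ht.1
  obtain ⟨h1, h2⟩ := points_subset_quadric_iff.1 hM
  exact ⟨M, h1, h2, hMt⟩

theorem one_le_index (ht : HasIndex L.quadric t) : 1 ≤ t := by
  obtain ⟨M, hM, hQ⟩ := L.ruled
  exact ht.2 ⟨M, hQ, hM⟩

/-- A subspace inside S misses T, so the projection to B is injective on it; since it preserves the
form, the image lies on the basic quadric. -/
theorem projDim_le_index [FiniteDimensional K V] (ht : HasIndex L.quadric t) {M : Submodule K V}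
    (hM : points M ⊆ L.S) : projDim M ≤ t := by
  have h0 : ∀ v ∈ M, (L.B.subtype ∘ₗ L.proj) v = 0 → v = 0 := by
    intro v hv hp
    by_contra hne
    exact (isPt_of_points_subset hM hv hne).ne (Subtype.ext hp)
  have h1 : projDim (M.map (L.B.subtype ∘ₗ L.proj)) = projDim M := by
    rw [projDim, projDim, finrank_map_of_injOn h0]
  rw [← h1]
  refine ht.2 ⟨_, points_subset_quadric_iff.2 ⟨?_, points_subset_S ?_⟩, rfl⟩
  · rintro _ ⟨v, -, rfl⟩
    exact (L.proj v).2
  · rintro _ ⟨v, hv, rfl⟩ hne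
    have hv0 : v ≠ 0 := by
      rintro rfl
      simp at hne
    exact isPt_of_mem_B (L.proj v).2 hne
      ((L.qf_proj v).trans (isPt_of_points_subset hM hv hv0).qf_eq)

/-! ### Classification of hyperplane sections. -/

/-- A functional vanishing on `T` is represented by a vector of `B`. -/
theorem exists_eq_bil [FiniteDimensional K V] (h2 : (2 : K) ≠ 0) {f : V →ₗ[K] K}
    (hf : L.T ≤ LinearMap.ker f) : ∃ x ∈ L.B, ∀ v ∈ L.ambient, f v = L.bil x v := by
  have hinj : Function.Injective (QuadraticMap.polarBilin L.form : L.B →ₗ[K] Dual K L.B) := by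
    refine (injective_iff_map_eq_zero _).2 fun b hb => Subtype.ext ?_
    refine L.eq_zero_of_bil_eq_zero h2 b.2 fun c hc => ?_
    rw [bil_apply, L.proj_of_mem_B b.2, L.proj_of_mem_B hc]
    exact LinearMap.congr_fun hb ⟨c, hc⟩
  have hsurj := (LinearMap.injective_iff_surjective_of_finrank_eq_finrank
    (Subspace.dual_finrank_eq (K := K) (V := L.B)).symm).1 hinj
  obtain ⟨x, hx⟩ := hsurj (f ∘ₗ L.B.subtype)
  refine ⟨x, x.2, fun v hv => ?_⟩
  have h1 : f (v - L.proj v) = 0 := hf (L.sub_proj_mem_T hv)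
  rw [map_sub, sub_eq_zero] at h1
  rw [h1, bil_apply, L.proj_of_mem_B x.2]
  exact (LinearMap.congr_fun hx (L.proj v)).symm

theorem projDim_T : projDim L.T = L.a - 1 := by
  simp [a]

/-- Hyperplanes containing `T` that meet `B` in a nondegenerate section. -/
theorem inter_ker_mem_classL_of_qf_ne_zero [FiniteDimensional K V] (h2 : (2 : K) ≠ 0)
    (ht : HasIndex L.quadric t) {f : V →ₗ[K] K} {x : V} (hf : L.T ≤ LinearMap.ker f)
    (hx : x ∈ L.B) (hfx : ∀ v ∈ L.ambient, f v = L.bil x v) (hq : L.qf x ≠ 0) :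
    L.S ∩ points (LinearMap.ker f) ∈ L.classL L.a (L.ν - 1) (t - 1) ∨
      L.S ∩ points (LinearMap.ker f) ∈ L.classL L.a (L.ν - 1) t := by
  set U : Submodule K V := L.B ⊓ LinearMap.ker f with hU
  have ht1 := one_le_index ht
  have hfxx : f x ≠ 0 := by
    rw [hfx x (L.B_le_ambient hx), bil_self]
    exact mul_ne_zero h2 hq
  -- As x is not self-orthogonal, B is the orthogonal sum of U and the span of x.
  have hnd : ∀ z ∈ U, (∀ u ∈ U, L.bil z u = 0) → z = 0 := by
    rintro z ⟨hzB, hzf⟩ hz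
    refine L.eq_zero_of_bil_eq_zero h2 hzB fun b hb => ?_
    have hxz : L.bil z x = 0 := by
      rw [L.bil_comm, ← hfx z (L.B_le_ambient hzB)]
      exact hzf
    have := hz (b - (f b / f x) • x) ⟨L.B.sub_mem hb (L.B.smul_mem _ hx), by
      simp [hfxx]⟩
    simpa [hxz] using this
  have hd : projDim U = L.ν - 1 + 1 := by
    have := finrank_inf_ker_add_one hx hfxx
    rw [← hU] at this
    simp only [projDim, ν]
    omega
  have hcone : L.IsAffineCone (L.S ∩ points (LinearMap.ker f)) (L.S ∩ points U) L.a := by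
    refine ⟨L.T, le_rfl, projDim_T, inter_points_eq_affineCone le_rfl hf (fun v _ h => h)
      (Set.inter_subset_inter_right _ (points_mono inf_le_right)) fun v hv hv' => ?_⟩
    have hT := L.sub_proj_mem_T hv'.mem
    refine ⟨_, hT, L.proj v, has_inter_points.2 ⟨L.has_S.2 ?_, (L.proj v).2, ?_⟩, by simp⟩
    · exact isPt_of_mem_B (L.proj v).2 (fun h => hv'.ne (Subtype.ext h))
        ((L.qf_proj v).trans hv'.qf_eq)
    · have h1 := (LinearMap.ker f).sub_mem hv (hf hT)
      simpa using h1
  have hUE : U ≤ L.ambient := inf_le_left.trans L.B_le_ambient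
  obtain ⟨M, hMB, hMS, hMt⟩ := exists_projDim_eq_index ht
  have hM1 : t - 1 ≤ projDim (M ⊓ LinearMap.ker f) := by
    have := finrank_le_finrank_inf_ker_add_one M f
    simp only [projDim] at hMt ⊢
    omega
  -- A hyperplane cuts M down by at most one dimension; the index is t or t - 1 according to whether
  -- U still holds a t-dimensional generator.
  by_cases hex : ∃ N ≤ U, points N ⊆ L.S ∧ projDim N = t
  · exact Or.inr ⟨U, _, isSubquadric_inter_points h2 hUE hnd hd
      (hasIndex_inter_points hex fun N _ hN => projDim_le_index ht hN) (by omega), hcone⟩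
  · have hle : ∀ N ≤ U, points N ⊆ L.S → projDim N ≤ t - 1 := by
      intro N hNU hNS
      have h1 := projDim_le_index ht hNS
      have h3 : projDim N ≠ t := fun h => hex ⟨N, hNU, hNS, h⟩
      omega
    have hMU : M ⊓ LinearMap.ker f ≤ U := inf_le_inf_right _ hMB
    have hMS' : points (M ⊓ LinearMap.ker f) ⊆ L.S := (points_mono inf_le_left).trans hMS
    exact Or.inl ⟨U, _, isSubquadric_inter_points h2 hUE hnd hd
      (hasIndex_inter_points ⟨_, hMU, hMS', le_antisymm (hle _ hMU hMS') hM1⟩ hle) (by omega),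
      hcone⟩

/-- The join of a point with an orthogonal singular subspace of `B` is singular. -/
theorem points_sup_span_singleton_subset {M : Submodule K V} {x : V} (hMB : M ≤ L.B)
    (hM : points M ⊆ L.S) (hx : x ∈ L.B) (hq : L.qf x = 0) (hMx : ∀ v ∈ M, L.bil x v = 0) :
    points (M ⊔ Submodule.span K {x}) ⊆ L.S := by
  refine points_subset_S fun v hv h0 => ?_
  obtain ⟨m, hm, y, hy, rfl⟩ := Submodule.mem_sup.1 hv
  obtain ⟨c, rfl⟩ := Submodule.mem_span_singleton.1 hy
  refine isPt_of_mem_B (L.B.add_mem (hMB hm) (L.B.smul_mem _ hx)) h0 ?_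
  have hqm : L.qf m = 0 := by
    by_cases hm0 : m = 0
    · simp [hm0]
    · exact (isPt_of_points_subset hM hm hm0).qf_eq
  rw [qf_add_smul, hqm, hq, L.bil_comm, hMx m hm]
  simp

/-- Hyperplanes containing `T` that meet `B` in a tangent hyperplane of the basic quadric. -/
theorem inter_ker_mem_classS [FiniteDimensional K V] (h2 : (2 : K) ≠ 0)
    (ht : HasIndex L.quadric t) {f : V →ₗ[K] K} {x : V} (hf : L.T ≤ LinearMap.ker f)
    (hx : x ∈ L.B) (hx0 : x ≠ 0) (hfx : ∀ v ∈ L.ambient, f v = L.bil x v) (hq : L.qf x = 0) :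
    L.S ∩ points (LinearMap.ker f) ∈ L.classS L.a t (L.ν - 2) (t - 1) := by
  have ht1 := one_le_index ht
  have hfB : ∀ v ∈ L.B, f v = L.bil x v := fun v hv => hfx v (L.B_le_ambient hv)
  have hfxx : f x = 0 := by rw [hfB x hx, bil_self, hq, mul_zero]
  obtain ⟨y, hyB, hy⟩ : ∃ y ∈ L.B, f y = 1 := by
    by_contra! hc
    refine hx0 (L.eq_zero_of_bil_eq_zero h2 hx fun b hb => ?_)
    by_contra hxb
    rw [← hfB b hb] at hxb
    exact hc ((f b)⁻¹ • b) (L.B.smul_mem _ hb) (by simp [hxb])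
  set g : V →ₗ[K] K := L.bil y with hg
  have hgx : g x = 1 := by rw [hg, L.bil_comm, ← hfB y hyB, hy]
  -- The orthogonal in B of the nondegenerate plane spanned by x and y; it complements x within the
  -- orthogonal of x in B.
  set U : Submodule K V := (L.B ⊓ LinearMap.ker f) ⊓ LinearMap.ker g with hU
  have hUB : U ≤ L.B := inf_le_left.trans inf_le_left
  have hxf : x ∈ L.B ⊓ LinearMap.ker f := ⟨hx, hfxx⟩
  have hxU : x ∉ U := fun h => by
    have : g x = 0 := h.2
    rw [hgx] at this
    exact one_ne_zero this
  have hsplit : ∀ v ∈ L.B, f v = 0 → v - g v • x ∈ U := fun v hv hfv =>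
    ⟨⟨L.B.sub_mem hv (L.B.smul_mem _ hx), by simp [hfv, hfxx]⟩, by simp [hgx]⟩
  have hnd : ∀ z ∈ U, (∀ u ∈ U, L.bil z u = 0) → z = 0 := by
    rintro z ⟨⟨hzB, hzf⟩, hzg⟩ hz
    refine L.eq_zero_of_bil_eq_zero h2 hzB fun b hb => ?_
    have hxz : L.bil z x = 0 := by
      rw [L.bil_comm, ← hfB z hzB]
      exact hzf
    have hyz : L.bil z y = 0 := by
      rw [L.bil_comm]
      exact hzg
    have := hz _ (hsplit (b - f b • y) (L.B.sub_mem hb (L.B.smul_mem _ hyB)) (by simp [hy]))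
    simpa [hxz, hyz] using this
  have hd : projDim U = L.ν - 2 + 1 := by
    have h1 := finrank_inf_ker_add_one (f := f) hyB (by rw [hy]; exact one_ne_zero)
    have h3 := finrank_inf_ker_add_one (f := g) hxf (by rw [hgx]; exact one_ne_zero)
    rw [← hU] at h3
    simp only [projDim, ν]
    omega
  have hjoin : ∀ N ≤ L.B, points N ⊆ L.S → N ≤ LinearMap.ker f →
      points (N ⊔ Submodule.span K {x}) ⊆ L.S := fun N hNB hNS hNf =>
    points_sup_span_singleton_subset hNB hNS hx hq fun v hv => by
      rw [← hfB v (hNB hv)]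
      exact hNf hv
  -- Joining x to N raises the dimension by one and stays inside the quadric.
  have hle : ∀ N ≤ U, points N ⊆ L.S → projDim N ≤ t - 1 := by
    intro N hNU hNS
    have h1 := projDim_le_index ht (hjoin N (hNU.trans hUB) hNS
      (hNU.trans (inf_le_left.trans inf_le_right)))
    rw [projDim, finrank_sup_span_singleton_of_notMem fun h => hxU (hNU h)] at h1
    simp only [projDim]
    push_cast at h1
    omega
  have hex : ∃ N ≤ U, points N ⊆ L.S ∧ projDim N = t - 1 := by
    obtain ⟨M, hMB, hMS, hMt⟩ := exists_projDim_eq_index ht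
    -- A generator orthogonal to x: M itself if it contains x, otherwise the part of M orthogonal to
    -- x joined with x. Intersecting with `ker g` then costs at most one dimension.
    obtain ⟨N, hNB, hNf, hNS, hN⟩ : ∃ N ≤ L.B, N ≤ LinearMap.ker f ∧ points N ⊆ L.S ∧
        t ≤ projDim N := by
      by_cases hxM : x ∈ M
      · refine ⟨M, hMB, fun v hv => ?_, hMS, hMt.ge⟩
        rw [LinearMap.mem_ker, hfB v (hMB hv)]
        exact L.bil_eq_zero_of_points_subset (hMS.trans Set.sdiff_subset) hxM hv
      · have h1 := finrank_le_finrank_inf_ker_add_one M f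
        refine ⟨(M ⊓ LinearMap.ker f) ⊔ Submodule.span K {x},
          sup_le (inf_le_left.trans hMB) ((Submodule.span_singleton_le_iff_mem _ _).2 hx),
          sup_le inf_le_right ((Submodule.span_singleton_le_iff_mem _ _).2 hfxx),
          hjoin _ (inf_le_left.trans hMB) ((points_mono inf_le_left).trans hMS) inf_le_right, ?_⟩
        rw [projDim, finrank_sup_span_singleton_of_notMem
          fun h => hxM (Submodule.mem_inf.1 h).1]
        simp only [projDim] at hMt
        push_cast
        omega
    have hNU : N ⊓ LinearMap.ker g ≤ U := inf_le_inf_right _ (le_inf hNB hNf)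
    have hNS' : points (N ⊓ LinearMap.ker g) ⊆ L.S := (points_mono inf_le_left).trans hNS
    refine ⟨_, hNU, hNS', le_antisymm (hle _ hNU hNS') ?_⟩
    have := finrank_le_finrank_inf_ker_add_one N g
    simp only [projDim] at hN ⊢
    omega
  have hsub := isSubquadric_inter_points h2 (hUB.trans L.B_le_ambient) hnd hd
    (hasIndex_inter_points hex hle) (by omega)
  have hcone : ∀ v, Has (cone (Submodule.span K {x}) (L.S ∩ points U)) v ↔
      v ≠ 0 ∧ v ∈ L.B ∧ f v = 0 ∧ L.qf v = 0 := by
    intro v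
    constructor
    · rintro ⟨h0, hv⟩
      obtain ⟨u, hu0, hu, w, c, hw, rfl⟩ := (mk_mem_cone h0).1 hv
      obtain ⟨d, rfl⟩ := Submodule.mem_span_singleton.1 hw
      obtain ⟨huS, huU⟩ := has_inter_points.1 ⟨hu0, hu⟩
      have huf : f u = 0 := huU.1.2
      refine ⟨h0, L.B.add_mem (L.B.smul_mem _ hx) (L.B.smul_mem _ (hUB huU)),
        by simp [hfxx, huf], ?_⟩
      rw [qf_add_smul, qf_smul, hq, (L.has_S.1 huS).qf_eq, map_smul, LinearMap.smul_apply,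
        ← hfB u (hUB huU), huf]
      simp
    · rintro ⟨h0, hvB, hvf, hvq⟩
      refine ⟨h0, (mk_mem_cone h0).2 ?_⟩
      have hvU := hsplit v hvB hvf
      -- The vertex x needs some base point in the section by U, which is nonempty because t - 1 ≥
      -- 0.
      by_cases hz : v - g v • x = 0
      · obtain ⟨p, hp⟩ := hsub.2.2.1
        obtain ⟨hp0, hp'⟩ := has_rep.2 hp
        exact ⟨_, hp0, hp', v, 0, Submodule.mem_span_singleton.2 ⟨g v, (sub_eq_zero.1 hz).symm⟩,
          by simp⟩
      · have hqz : L.qf (v - g v • x) = 0 := by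
          rw [sub_eq_add_neg, ← neg_smul, qf_add_smul, hvq, hq, L.bil_comm v x, ← hfB v hvB, hvf]
          simp
        obtain ⟨_, hm⟩ := has_inter_points.2 ⟨L.has_S.2 (isPt_of_mem_B (hUB hvU) hz hqz), hvU⟩
        exact ⟨_, hz, hm, g v • x, 1,
          Submodule.smul_mem _ _ (Submodule.mem_span_singleton_self x), by simp⟩
  have hconeS : cone (Submodule.span K {x}) (L.S ∩ points U) ⊆
      L.S ∩ points (LinearMap.ker f) := subset_iff_has.2 fun v hv => by
    obtain ⟨h0, hvB, hvf, hvq⟩ := (hcone v).1 hv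
    exact has_inter_points.2 ⟨L.has_S.2 (isPt_of_mem_B hvB h0 hvq), hvf⟩
  refine ⟨U, Submodule.span K {x}, _, hsub, ?_, ?_, hconeS.trans Set.inter_subset_left, L.T, le_rfl,
    projDim_T, inter_points_eq_affineCone le_rfl hf (fun v _ h => h) hconeS fun v hv hv' => ?_⟩
  · exact ((Submodule.disjoint_span_singleton' hx0).2 hxU).symm
  · rw [projDim, finrank_span_singleton hx0]
    ring
  · have hT := L.sub_proj_mem_T hv'.mem
    refine ⟨_, hT, L.proj v, (hcone _).2 ⟨fun h => hv'.ne (Subtype.ext h), (L.proj v).2, ?_,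
      (L.qf_proj v).trans hv'.qf_eq⟩, by simp⟩
    have h1 := (LinearMap.ker f).sub_mem hv (hf hT)
    simpa using h1

/-- Hyperplanes not containing `T`. -/
theorem inter_ker_mem_classL_of_not_le [FiniteDimensional K V] (h2 : (2 : K) ≠ 0)
    (ht : HasIndex L.quadric t) {f : V →ₗ[K] K} (hf : ¬ L.T ≤ LinearMap.ker f) :
    L.S ∩ points (LinearMap.ker f) ∈ L.classL (L.a - 1) L.ν t := by
  have ht1 := one_le_index ht
  obtain ⟨e, heT, hfe⟩ : ∃ e ∈ L.T, f e = 1 := by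
    obtain ⟨e, he, hef⟩ := SetLike.not_le_iff_exists.1 hf
    exact ⟨(f e)⁻¹ • e, L.T.smul_mem _ he, by
      rw [map_smul, smul_eq_mul, inv_mul_cancel₀ hef]⟩
  -- The projection onto `ker f` along e. Since e lies in T, it preserves `proj` and `qf`, so it
  -- carries B to an isometric copy inside the hyperplane.
  set g : V →ₗ[K] V := LinearMap.id - f.smulRight e with hg
  have hgv : ∀ v, g v = v - f v • e := fun v => by simp [hg]
  have hfg : ∀ v, f (g v) = 0 := fun v => by simp [hgv, hfe]
  have hpg : ∀ v, L.proj (g v) = L.proj v := fun v => by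
    simp [hgv, L.proj_of_mem_T heT]
  have hqg : ∀ v, L.qf (g v) = L.qf v := fun v => by rw [qf_apply, hpg, qf_apply]
  have hgE : ∀ v ∈ L.ambient, g v ∈ L.ambient := fun v hv => by
    rw [hgv]
    exact L.ambient.sub_mem hv (L.ambient.smul_mem _ (L.T_le_ambient heT))
  have hinj : ∀ v ∈ L.B, g v = 0 → v = 0 := fun v hv h => by
    have h1 := hpg v
    rw [h, map_zero, L.proj_of_mem_B hv] at h1
    exact (congrArg Subtype.val h1).symm
  have hUE : L.B.map g ≤ L.ambient := by
    rintro _ ⟨b, hb, rfl⟩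
    exact hgE b (L.B_le_ambient hb)
  have hnd : ∀ z ∈ L.B.map g, (∀ u ∈ L.B.map g, L.bil z u = 0) → z = 0 := by
    rintro _ ⟨z, hzB, rfl⟩ hz
    rw [L.eq_zero_of_bil_eq_zero h2 hzB fun b hb => ?_, map_zero]
    have := hz _ (Submodule.mem_map_of_mem hb)
    rwa [bil_apply, hpg, hpg, ← bil_apply] at this
  have hd : projDim (L.B.map g) = L.ν + 1 := by
    rw [ν, projDim, projDim, finrank_map_of_injOn hinj]
    ring
  have hex : ∃ N ≤ L.B.map g, points N ⊆ L.S ∧ projDim N = t := by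
    obtain ⟨M, hMB, hMS, hMt⟩ := exists_projDim_eq_index ht
    refine ⟨M.map g, Submodule.map_mono hMB, points_subset_S ?_, ?_⟩
    · rintro _ ⟨v, hv, rfl⟩ h0
      have hv' := isPt_of_points_subset hMS hv (by rintro rfl; simp at h0)
      exact ⟨hgE v hv'.mem, by rw [hpg]; exact hv'.ne, by rw [hqg, hv'.qf_eq]⟩
    · rw [projDim, finrank_map_of_injOn fun v hv => hinj v (hMB hv)]
      exact hMt
  refine ⟨L.B.map g, _, isSubquadric_inter_points h2 hUE hnd hd
    (hasIndex_inter_points hex fun N _ hN => projDim_le_index ht hN) (by omega),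
    L.T ⊓ LinearMap.ker f, inf_le_left, ?_, inter_points_eq_affineCone inf_le_left inf_le_right
      (fun v hv hT => ⟨hT, hv⟩) (Set.inter_subset_inter_right _ (points_mono ?_))
      fun v hv hv' => ?_⟩
  · have := finrank_inf_ker_add_one (f := f) heT (by rw [hfe]; exact one_ne_zero)
    simp only [projDim, a]
    omega
  · rintro _ ⟨b, -, rfl⟩
    exact hfg b
  · have hpt : L.IsPt (g (L.proj v)) := ⟨hgE _ (L.B_le_ambient (L.proj v).2), by
      rw [hpg, proj_proj]; exact hv'.ne, by rw [hqg, qf_proj, hv'.qf_eq]⟩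
    -- Both v and `g (proj v)` lie in `ker f` and have the same projection, so they differ by a
    -- vector of T in `ker f`.
    refine ⟨v - g (L.proj v), ⟨?_, ?_⟩, g (L.proj v), has_inter_points.2
      ⟨L.has_S.2 hpt, Submodule.mem_map_of_mem (L.proj v).2⟩, by simp⟩
    · refine (L.proj_eq_zero_iff (L.ambient.sub_mem hv'.mem hpt.mem)).1 ?_
      rw [map_sub, hpg, proj_proj, sub_self]
    · exact (LinearMap.ker f).sub_mem hv (hfg _)

end LaguerreSpace

theorem mainTheorem11 {K V : Type*} [Field K] [AddCommGroup V] [Module K V]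
    [FiniteDimensional K V] (h2 : (2 : K) ≠ 0) (L : LaguerreSpace K V)
    (t : ℤ) (ht : Laguerre.HasIndex L.quadric t)
    (X : Set (ℙ K V)) (hX : L.IsMaximalProperSubspace X) :
    X ∈ L.classL L.a (L.ν - 1) (t - 1) ∨
    X ∈ L.classL L.a (L.ν - 1) t ∨
    X ∈ L.classL (L.a - 1) L.ν t ∨
    X ∈ L.classS L.a t (L.ν - 2) (t - 1) := by
  obtain ⟨f, ⟨v, hv, hfv⟩, rfl⟩ := hX.exists_eq_inter_ker h2
  by_cases hf : L.T ≤ LinearMap.ker f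
  · obtain ⟨x, hx, hfx⟩ := LaguerreSpace.exists_eq_bil h2 hf
    by_cases hq : L.qf x = 0
    · have hx0 : x ≠ 0 := by
        rintro rfl
        exact hfv (by rw [hfx v hv, map_zero, LinearMap.zero_apply])
      exact Or.inr (Or.inr (Or.inr
        (LaguerreSpace.inter_ker_mem_classS h2 ht hf hx hx0 hfx hq)))
    · rcases LaguerreSpace.inter_ker_mem_classL_of_qf_ne_zero h2 ht hf hx hfx hq with h | h
      exacts [Or.inl h, Or.inr (Or.inl h)]
  · exact Or.inr (Or.inr (Or.inl (LaguerreSpace.inter_ker_mem_classL_of_not_le h2 ht hf)))
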